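/- Let $X$ be a compact Hausdorff space and $A$ a unital $C^*$-algebra. A (right) Hilbert $A$-module is finitely generated projective if it is isomorphic to an orthogonal direct summand of $A^n$ for some $n$; a finitely generated projective Hilbert $A$-module bundle over $X$ is a topological space $E\to X$ whose fibers are finitely generated projective Hilbert $A$-modules and which is locally isomorphic to products $U\times V$ ($U\subset X$ open, $V$ a Hilbert $A$-module) through homeomorphisms that are fiberwise (inner product preserving) isomorphisms of Hilbert $A$-modules. Let $K(X;A)$ be the Grothendieck group of the monoid, under direct sum, of isomorphism classes of finitely generated projective Hilbert $A$-module bundles over $X$, and let $K_0(C(X,A))$ be the Grothendieck group of the isomorphism classes of finitely generated projective right modules over the $C^*$-algebra $C(X,A)$ of continuous functions $X\to A$. Then for every finitely generated projective Hilbert $A$-module bundle $E$ the right $C(X,A)$-module $C(X,E)$ of continuous sections of $E$ is finitely generated and projective, and there is an isomorphism of groups $$K(X;A)\;\xrightarrow{\ \cong\ }\;K_0(C(X,A)),\qquad [E]\mapsto [C(X,E)].$$ Moreover $C(X,A)\cong C(X)\otimes A$, where $\otimes$ is the minimal $C^*$-algebra tensor product, and this is the only $C^*$-tensor product of $C(X)$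 and $A$: there is a $*$-homomorphism $\iota\colon C(X)\otimes_{\mathrm{alg}}A\to C(X,A)$ with $\iota(f\otimes a)(x)=f(x)a$; it is injective with dense range; $\|\iota(t)\|$ is the minimal $C^*$-norm of $t$ for every $t\in C(X)\otimes_{\mathrm{alg}}A$; and for every injective unital $*$-homomorphism $j$ from $C(X)\otimes_{\mathrm{alg}}A$ to a unital $C^*$-algebra one has $\|j(t)\|=\|\iota(t)\|$ for all $t$. -/

import Mathlib

/-!
A projective Hilbert module bundle over a compact space has a finite frame: a partition of unity
glues local trivializations to an isometric embedding into a trivial bundle `X × Aⁿ`, whose range is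
the range of a continuous family of projections, that is of a projection over `C(X, A)`. Hence the
module of sections is finitely generated and projective. Conversely an idempotent matrix over
`C(X, A)` can be replaced by a similar projection, whose fibrewise ranges form a bundle, and by
polar decomposition an isomorphism between modules of sections can be made fibrewise unitary.

For the tensor product, positivity of `j t` for a `*`-homomorphism `j` on `C(X) ⊗ A` follows from
pointwise positivity of `t`, because `j t` is approximated by sums `∑ i, j (fᵢ ⊗ t(cᵢ))` over a
partition of unity. If `j` is injective the converse holds: a negative part of `t(x₀)` would
produce, after localization near `x₀`, a nonzero positive elementary tensor with nonpositive image.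
Since `‖j t‖ ≤ r` means that `j (r² - t* t)` is positive, all injective `j` give the same norm.
-/

open scoped TensorProduct ENNReal
open MulOpposite

universe u v w

noncomputable section

/-! ### Right Hilbert modules over a unital C⋆-algebra -/

/-- A (right) Hilbert `A`-module: a right `A`-module (i.e. a module over `Aᵐᵒᵖ`) with an `A`-valued
inner product, `A`-linear in the second variable, which is a Banach space for the norm
`‖⟪v, v⟫‖ ^ (1/2)`.  (Mathlib's `CStarModule` treats left modules.) -/
class HilbertModule (A : Type*) [CStarAlgebra A] [PartialOrder A] (V : Type*)
    [NormedAddCommGroup V] [Module Aᵐᵒᵖ V] extends Inner A V where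
  inner_op_smul_right (v w : V) (a : A) : inner v (op a • w) = inner v w * a
  inner_add_left (v₁ v₂ v₃ : V) : inner (v₁ + v₂) v₃ = inner v₁ v₃ + inner v₂ v₃
  star_inner (v w : V) : star (inner v w) = inner w v
  inner_self_nonneg (v : V) : 0 ≤ inner v v
  inner_self_eq_zero (v : V) : inner v v = 0 ↔ v = 0
  norm_eq_sqrt (v : V) : ‖v‖ = √‖inner v v‖
  complete : CompleteSpace V

/-- An isomorphism of Hilbert `A`-modules: an `A`-linear bijection preserving the inner products. -/
structure HilbertModuleIso (A : Type*) [CStarAlgebra A] [PartialOrder A] (V W : Type*)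
    [NormedAddCommGroup V] [Module Aᵐᵒᵖ V] [HilbertModule A V]
    [NormedAddCommGroup W] [Module Aᵐᵒᵖ W] [HilbertModule A W] extends V ≃ₗ[Aᵐᵒᵖ] W where
  inner_map (v w : V) : inner A (toLinearEquiv v) (toLinearEquiv w) = inner A v w

/-- A Hilbert `A`-module is finitely generated projective if, for some `n`, it is isomorphic as a
Hilbert `A`-module to an orthogonal direct summand of `A ^ n`, where `A ^ n` carries the inner
product `∑ k, star (a k) * b k`: there is an `A`-linear map `i : V → A ^ n` preserving the inner
products such that every `y : A ^ n` is the sum of an element of the range of `i` and an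
element orthogonal to the range of `i`. -/
def HilbertModule.IsFGP (A : Type*) [CStarAlgebra A] [PartialOrder A] (V : Type*)
    [NormedAddCommGroup V] [Module Aᵐᵒᵖ V] [HilbertModule A V] : Prop :=
  ∃ (n : ℕ) (i : V →ₗ[Aᵐᵒᵖ] (Fin n → A)),
    (∀ v w, ∑ k, star (i v k) * i w k = inner A v w) ∧
    ∀ y : Fin n → A, ∃ v, ∀ w, ∑ k, star (i w k) * (y k - i v k) = 0

namespace HilbertModuleIso

variable {A : Type*} [CStarAlgebra A] [PartialOrder A] {V W Z : Type*}
  [NormedAddCommGroup V] [Module Aᵐᵒᵖ V] [HilbertModule A V]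
  [NormedAddCommGroup W] [Module Aᵐᵒᵖ W] [HilbertModule A W]
  [NormedAddCommGroup Z] [Module Aᵐᵒᵖ Z] [HilbertModule A Z]

def refl (A : Type*) [CStarAlgebra A] [PartialOrder A] (V : Type*)
    [NormedAddCommGroup V] [Module Aᵐᵒᵖ V] [HilbertModule A V] : HilbertModuleIso A V V where
  toLinearEquiv := LinearEquiv.refl _ _
  inner_map _ _ := rfl

def symm (φ : HilbertModuleIso A V W) : HilbertModuleIso A W V where
  toLinearEquiv := φ.toLinearEquiv.symm
  inner_map v w := by
    rw [← φ.inner_map, LinearEquiv.apply_symm_apply, LinearEquiv.apply_symm_apply]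

def trans (φ : HilbertModuleIso A V W) (ψ : HilbertModuleIso A W Z) : HilbertModuleIso A V Z where
  toLinearEquiv := φ.toLinearEquiv.trans ψ.toLinearEquiv
  inner_map v w := by
    rw [← φ.inner_map, ← ψ.inner_map]; rfl

end HilbertModuleIso

namespace HilbertModule

variable {A : Type*} [CStarAlgebra A] [PartialOrder A]

section Basic

variable {V : Type*} [NormedAddCommGroup V] [Module Aᵐᵒᵖ V] [HilbertModule A V]

theorem inner_add_right (v₁ v₂ v₃ : V) :
    inner A v₁ (v₂ + v₃) = inner A v₁ v₂ + inner A v₁ v₃ := by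
  rw [← star_inner (A := A) (v₂ + v₃) v₁, inner_add_left, star_add, star_inner, star_inner]

theorem inner_op_smul_left (v w : V) (a : A) :
    inner A (op a • v) w = star a * inner A v w := by
  rw [← star_inner (A := A) w, inner_op_smul_right, star_mul, star_inner]

theorem norm_op_smul_le (a : Aᵐᵒᵖ) (v : V) : ‖a • v‖ ≤ ‖a‖ * ‖v‖ := by
  rw [norm_eq_sqrt (A := A), norm_eq_sqrt (A := A) v]
  obtain ⟨a, rfl⟩ := op_surjective a
  rw [inner_op_smul_right, inner_op_smul_left, MulOpposite.norm_op]
  refine (Real.sqrt_le_left (by positivity)).2 ?_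
  rw [mul_pow, Real.sq_sqrt (norm_nonneg _)]
  calc ‖star a * inner A v v * a‖ ≤ ‖star a‖ * ‖inner A v v‖ * ‖a‖ :=
        (norm_mul_le _ _).trans (by gcongr; exact norm_mul_le _ _)
    _ = ‖a‖ ^ 2 * ‖inner A v v‖ := by rw [norm_star]; ring

variable (A V) in
theorem continuousSMul : ContinuousSMul Aᵐᵒᵖ V :=
  haveI : IsBoundedSMul Aᵐᵒᵖ V := .of_norm_smul_le norm_op_smul_le
  inferInstance

end Basic

/-- The zero module is a Hilbert `A`-module. -/
instance : HilbertModule A PUnit where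
  inner _ _ := 0
  inner_op_smul_right _ _ _ := by simp
  inner_add_left _ _ _ := by simp
  star_inner _ _ := by simp
  inner_self_nonneg _ := le_rfl
  inner_self_eq_zero _ := by simp
  norm_eq_sqrt _ := by simp
  complete := inferInstance

theorem isFGP_punit : IsFGP A PUnit :=
  ⟨0, 0, fun _ _ => by simp; rfl, fun _ => ⟨0, fun _ => by simp⟩⟩

end HilbertModule

/-! ### Direct sums of Hilbert modules -/

/-- The direct sum of two Hilbert `A`-modules, with inner product
`⟪(v₁, w₁), (v₂, w₂)⟫ = ⟪v₁, v₂⟫ + ⟪w₁, w₂⟫` and the corresponding norm. -/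
@[nolint unusedArguments]
def HilbertSum (_A : Type*) (V W : Type*) : Type _ := V × W

namespace HilbertSum

variable {A : Type*} [CStarAlgebra A] [PartialOrder A] [StarOrderedRing A] {V W : Type*}
  [NormedAddCommGroup V] [Module Aᵐᵒᵖ V] [HilbertModule A V]
  [NormedAddCommGroup W] [Module Aᵐᵒᵖ W] [HilbertModule A W]

instance : AddCommGroup (HilbertSum A V W) := inferInstanceAs (AddCommGroup (V × W))
instance : Module Aᵐᵒᵖ (HilbertSum A V W) := inferInstanceAs (Module Aᵐᵒᵖ (V × W))
instance : Inner A (HilbertSum A V W) := ⟨fun p q => inner A p.1 q.1 + inner A p.2 q.2⟩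

instance : Norm (HilbertSum A V W) := ⟨fun p => √‖inner A p p‖⟩

theorem inner_def (p q : HilbertSum A V W) : inner A p q = inner A p.1 q.1 + inner A p.2 q.2 := rfl

theorem inner_self_eq_zero (p : HilbertSum A V W) : inner A p p = 0 ↔ p = 0 := by
  rw [inner_def, add_eq_zero_iff_of_nonneg (HilbertModule.inner_self_nonneg _)
    (HilbertModule.inner_self_nonneg _), HilbertModule.inner_self_eq_zero,
    HilbertModule.inner_self_eq_zero]
  exact (Prod.ext_iff (x := p) (y := (0 : V × W))).symm

theorem exists_normCore : ∃ _ : Module ℂ (HilbertSum A V W), NormedSpace.Core ℂ (HilbertSum A V W) := by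
  let : Module ℂ (HilbertSum A V W) := Module.compHom _ (algebraMap ℂ Aᵐᵒᵖ)
  let : CStarModule Aᵐᵒᵖ (HilbertSum A V W) :=
    { inner := fun p q => op (inner A p q)
      inner_add_right := fun {p q r} => by
        rw [← op_add]
        refine congrArg op ?_
        simp only [inner_def]
        rw [show (q + r).1 = q.1 + r.1 from rfl, show (q + r).2 = q.2 + r.2 from rfl,
          HilbertModule.inner_add_right, HilbertModule.inner_add_right]
        abel
      inner_self_nonneg := fun {p} => by
        show (0 : A) ≤ inner A p p
        exact add_nonneg (HilbertModule.inner_self_nonneg _) (HilbertModule.inner_self_nonneg _)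
      inner_self := fun {p} => by rw [op_eq_zero_iff, inner_self_eq_zero]
      inner_op_smul_right := fun {a p q} => by
        obtain ⟨a, rfl⟩ := op_surjective a
        rw [← op_mul]
        refine congrArg op ?_
        simp only [inner_def]
        rw [show (op a • q).1 = op a • q.1 from rfl, show (op a • q).2 = op a • q.2 from rfl,
          HilbertModule.inner_op_smul_right, HilbertModule.inner_op_smul_right, add_mul]
      inner_smul_right_complex := fun {z p q} => by
        rw [← op_smul]
        refine congrArg op ?_
        simp only [inner_def]
        rw [show (z • q).1 = op (algebraMap ℂ A z) • q.1 from rfl,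
          show (z • q).2 = op (algebraMap ℂ A z) • q.2 from rfl,
          HilbertModule.inner_op_smul_right, HilbertModule.inner_op_smul_right, ← add_mul,
          ← Algebra.commutes, ← Algebra.smul_def]
      star_inner := fun p q => by
        rw [← op_star, inner_def, inner_def, star_add, HilbertModule.star_inner,
          HilbertModule.star_inner]
      norm_eq_sqrt_norm_inner_self := fun p => rfl }
  exact ⟨inferInstance, CStarModule.normedSpaceCore Aᵐᵒᵖ⟩

instance : NormedAddCommGroup (HilbertSum A V W) :=
  letI := (exists_normCore (A := A) (V := V) (W := W)).choose
  NormedAddCommGroup.ofCore (exists_normCore (A := A) (V := V) (W := W)).choose_spec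

theorem norm_def (p : HilbertSum A V W) : ‖p‖ = √‖inner A p p‖ := rfl

theorem norm_fst_le (p : HilbertSum A V W) : ‖p.1‖ ≤ ‖p‖ := by
  rw [norm_def, HilbertModule.norm_eq_sqrt (A := A) p.1, inner_def]
  refine Real.sqrt_le_sqrt (CStarAlgebra.norm_le_norm_of_nonneg_of_le
    (HilbertModule.inner_self_nonneg _) ?_)
  exact le_add_of_nonneg_right (HilbertModule.inner_self_nonneg _)

theorem norm_snd_le (p : HilbertSum A V W) : ‖p.2‖ ≤ ‖p‖ := by
  rw [norm_def, HilbertModule.norm_eq_sqrt (A := A) p.2, inner_def]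
  refine Real.sqrt_le_sqrt (CStarAlgebra.norm_le_norm_of_nonneg_of_le
    (HilbertModule.inner_self_nonneg _) ?_)
  exact le_add_of_nonneg_left (HilbertModule.inner_self_nonneg _)

theorem norm_le (p : HilbertSum A V W) : ‖p‖ ≤ ‖p.1‖ + ‖p.2‖ := by
  rw [norm_def, HilbertModule.norm_eq_sqrt (A := A) p.1, HilbertModule.norm_eq_sqrt (A := A) p.2,
    inner_def]
  refine (Real.sqrt_le_left (by positivity)).2 ((norm_add_le _ _).trans ?_)
  nlinarith [Real.sq_sqrt (norm_nonneg (inner A p.1 p.1)),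
    Real.sq_sqrt (norm_nonneg (inner A p.2 p.2)), Real.sqrt_nonneg ‖inner A p.1 p.1‖,
    Real.sqrt_nonneg ‖inner A p.2 p.2‖]

/-- The projections and the inclusion of pairs, as additive maps. -/
def fstHom : HilbertSum A V W →+ V := ⟨⟨fun p => p.1, rfl⟩, fun _ _ => rfl⟩

def sndHom : HilbertSum A V W →+ W := ⟨⟨fun p => p.2, rfl⟩, fun _ _ => rfl⟩

def mkHom : V × W →+ HilbertSum A V W := ⟨⟨fun p => p, rfl⟩, fun _ _ => rfl⟩

theorem continuous_fst : Continuous (fun p : HilbertSum A V W => p.1) :=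
  AddMonoidHomClass.continuous_of_bound (fstHom (A := A) (V := V) (W := W)) 1
    fun p => by rw [one_mul]; exact norm_fst_le p

theorem continuous_snd : Continuous (fun p : HilbertSum A V W => p.2) :=
  AddMonoidHomClass.continuous_of_bound (sndHom (A := A) (V := V) (W := W)) 1
    fun p => by rw [one_mul]; exact norm_snd_le p

theorem continuous_mk : Continuous (mkHom (A := A) (V := V) (W := W)) := by
  refine AddMonoidHomClass.continuous_of_bound (mkHom (A := A) (V := V) (W := W))
    2 fun p => ?_
  refine (norm_le (mkHom (A := A) p)).trans ?_
  have h1 : ‖p.1‖ ≤ ‖p‖ := _root_.norm_fst_le p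
  have h2 : ‖p.2‖ ≤ ‖p‖ := _root_.norm_snd_le p
  have h : ‖(mkHom (A := A) p).1‖ + ‖(mkHom (A := A) p).2‖ = ‖p.1‖ + ‖p.2‖ := rfl
  linarith

instance : HilbertModule A (HilbertSum A V W) where
  inner_op_smul_right p q a := by
    simp only [inner_def]
    rw [show (op a • q).1 = op a • q.1 from rfl, show (op a • q).2 = op a • q.2 from rfl,
      HilbertModule.inner_op_smul_right, HilbertModule.inner_op_smul_right, add_mul]
  inner_add_left p q r := by
    simp only [inner_def]
    rw [show (p + q).1 = p.1 + q.1 from rfl, show (p + q).2 = p.2 + q.2 from rfl,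
      HilbertModule.inner_add_left, HilbertModule.inner_add_left]
    abel
  star_inner p q := by
    rw [inner_def, inner_def, star_add, HilbertModule.star_inner, HilbertModule.star_inner]
  inner_self_nonneg p :=
    add_nonneg (HilbertModule.inner_self_nonneg _) (HilbertModule.inner_self_nonneg _)
  inner_self_eq_zero := inner_self_eq_zero
  norm_eq_sqrt := norm_def
  complete := by
    have := HilbertModule.complete (A := A) (V := V)
    have := HilbertModule.complete (A := A) (V := W)
    refine Metric.complete_of_cauchySeq_tendsto fun u hu => ?_
    have h1 : CauchySeq fun n => (u n).1 := by
      refine (LipschitzWith.uniformContinuous (K := 1) ?_).comp_cauchySeq hu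
        (f := fun p : HilbertSum A V W => p.1)
      exact LipschitzWith.of_dist_le_mul fun p q => by
        rw [dist_eq_norm, dist_eq_norm, NNReal.coe_one, one_mul]; exact norm_fst_le (p - q)
    have h2 : CauchySeq fun n => (u n).2 := by
      refine (LipschitzWith.uniformContinuous (K := 1) ?_).comp_cauchySeq hu
        (f := fun p : HilbertSum A V W => p.2)
      exact LipschitzWith.of_dist_le_mul fun p q => by
        rw [dist_eq_norm, dist_eq_norm, NNReal.coe_one, one_mul]; exact norm_snd_le (p - q)
    obtain ⟨a, ha⟩ := cauchySeq_tendsto_of_complete h1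
    obtain ⟨b, hb⟩ := cauchySeq_tendsto_of_complete h2
    exact ⟨mkHom (a, b), (continuous_mk.tendsto (a, b)).comp (ha.prodMk_nhds hb)⟩

/-- The direct sum of two isomorphisms of Hilbert modules. -/
def congr {V' W' : Type*} [NormedAddCommGroup V'] [Module Aᵐᵒᵖ V'] [HilbertModule A V']
    [NormedAddCommGroup W'] [Module Aᵐᵒᵖ W'] [HilbertModule A W']
    (φ : HilbertModuleIso A V V') (ψ : HilbertModuleIso A W W') :
    HilbertModuleIso A (HilbertSum A V W) (HilbertSum A V' W') where
  toLinearEquiv := LinearEquiv.prodCongr φ.toLinearEquiv ψ.toLinearEquiv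
  inner_map p q := congrArg₂ (· + ·) (φ.inner_map p.1 q.1) (ψ.inner_map p.2 q.2)

variable (A V W) in
def comm : HilbertModuleIso A (HilbertSum A V W) (HilbertSum A W V) where
  toLinearEquiv := LinearEquiv.prodComm Aᵐᵒᵖ V W
  inner_map p q := add_comm (inner A p.2 q.2) (inner A p.1 q.1)

variable (A V W) in
def assoc (Z : Type*) [NormedAddCommGroup Z] [Module Aᵐᵒᵖ Z] [HilbertModule A Z] :
    HilbertModuleIso A (HilbertSum A (HilbertSum A V W) Z) (HilbertSum A V (HilbertSum A W Z)) where
  toLinearEquiv := LinearEquiv.prodAssoc Aᵐᵒᵖ V W Z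
  inner_map p q :=
    (add_assoc (inner A p.1.1 q.1.1) (inner A p.1.2 q.1.2) (inner A p.2 q.2)).symm

variable (A V) in
def zeroSum : HilbertModuleIso A (HilbertSum A PUnit.{w + 1} V) V where
  toLinearEquiv := LinearEquiv.uniqueProd (R := Aᵐᵒᵖ) (M := V) (M₂ := PUnit.{w + 1})
  inner_map p q := (zero_add (inner A p.2 q.2)).symm

theorem isFGP (hV : HilbertModule.IsFGP A V) (hW : HilbertModule.IsFGP A W) :
    HilbertModule.IsFGP A (HilbertSum A V W) := by
  obtain ⟨n, i, hi, hi'⟩ := hV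
  obtain ⟨m, j, hj, hj'⟩ := hW
  refine ⟨n + m,
    { toFun := fun p => Fin.append (i p.1) (j p.2)
      map_add' := fun p q => ?_
      map_smul' := fun a p => ?_ }, fun p q => ?_, fun y => ?_⟩
  · ext k
    refine Fin.addCases (fun k => ?_) (fun k => ?_) k
    · simp [show (p + q).1 = p.1 + q.1 from rfl]
    · simp [show (p + q).2 = p.2 + q.2 from rfl]
  · ext k
    refine Fin.addCases (fun k => ?_) (fun k => ?_) k
    · simp [show (a • p).1 = a • p.1 from rfl]
    · simp [show (a • p).2 = a • p.2 from rfl]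
  · simp [Fin.sum_univ_add, inner_def, hi, hj]
  · obtain ⟨v, hv⟩ := hi' fun k => y (Fin.castAdd m k)
    obtain ⟨w, hw⟩ := hj' fun k => y (Fin.natAdd n k)
    refine ⟨mkHom (v, w), fun p => ?_⟩
    have h1 : (mkHom (A := A) (v, w)).1 = v := rfl
    have h2 : (mkHom (A := A) (v, w)).2 = w := rfl
    simp [Fin.sum_univ_add, h1, h2, hv, hw]

end HilbertSum

/-! ### Hilbert module bundles -/

/-- The total space (disjoint union of the fibers) of a family of types, without topology. -/
@[ext]
structure FamilyTotal {X : Type*} (E : X → Type*) where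
  base : X
  vec : E base

/-- A fiberwise isomorphism `φ` of the restriction to `U` of a family `E` of Hilbert modules with
the constant family `V` is a local trivialization if the map
`E|_U → U × V` it defines is a homeomorphism. -/
structure IsLocalTrivialization {A : Type*} [CStarAlgebra A] [PartialOrder A] {X : Type*}
    [TopologicalSpace X] {E : X → Type*} [∀ x, NormedAddCommGroup (E x)]
    [∀ x, Module Aᵐᵒᵖ (E x)] [∀ x, HilbertModule A (E x)] [TopologicalSpace (FamilyTotal E)]
    {U : Set X} {V : Type*} [NormedAddCommGroup V] [Module Aᵐᵒᵖ V] [HilbertModule A V]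
    (φ : ∀ x : U, HilbertModuleIso A (E x) V) : Prop where
  continuous_toFun : Continuous fun p : {p : FamilyTotal E // p.base ∈ U} =>
    ((⟨p.1.base, p.2⟩, (φ ⟨p.1.base, p.2⟩).toLinearEquiv p.1.vec) : U × V)
  continuous_invFun : Continuous fun q : U × V =>
    (⟨⟨q.1, (φ q.1).toLinearEquiv.symm q.2⟩, q.1.2⟩ : {p : FamilyTotal E // p.base ∈ U})

/-- A Hilbert `A`-module bundle over `X`: a family of Hilbert `A`-modules with a topology on its
total space, which is locally trivial through fiberwise isomorphisms of Hilbert `A`-modules.  The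
typical fiber is allowed to vary. -/
structure HilbertBundle (A : Type v) [CStarAlgebra A] [PartialOrder A] (X : Type u)
    [TopologicalSpace X] where
  Fiber : X → Type (max u v)
  [fiberNormed : ∀ x, NormedAddCommGroup (Fiber x)]
  [fiberModule : ∀ x, Module Aᵐᵒᵖ (Fiber x)]
  [fiberHilbert : ∀ x, HilbertModule A (Fiber x)]
  [topTotal : TopologicalSpace (FamilyTotal Fiber)]
  continuous_base : Continuous fun p : FamilyTotal Fiber => p.base
  exists_trivialization : ∀ x₀ : X, ∃ U : Set X, IsOpen U ∧ x₀ ∈ U ∧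
    ∃ (V : Type (max u v)) (_ : NormedAddCommGroup V) (_ : Module Aᵐᵒᵖ V) (_ : HilbertModule A V)
      (φ : ∀ x : U, HilbertModuleIso A (Fiber x) V), IsLocalTrivialization φ

attribute [instance] HilbertBundle.fiberNormed HilbertBundle.fiberModule
  HilbertBundle.fiberHilbert HilbertBundle.topTotal

namespace HilbertBundle

variable {A : Type v} [CStarAlgebra A] [PartialOrder A] {X : Type u} [TopologicalSpace X]

/-- The total space of a bundle. -/
abbrev Total (E : HilbertBundle A X) : Type (max u v) := FamilyTotal E.Fiber

/-- The map of total spaces defined by a family of isomorphisms between the fibers. -/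
def totalMap {E F : HilbertBundle A X} (φ : ∀ x, HilbertModuleIso A (E.Fiber x) (F.Fiber x)) :
    E.Total → F.Total :=
  fun p => ⟨p.base, (φ p.base).toLinearEquiv p.vec⟩

/-- Two bundles are isomorphic if there is a homeomorphism between the total spaces which restricts
on each fiber to an isomorphism of Hilbert modules. -/
def IsIso (E F : HilbertBundle A X) : Prop :=
  ∃ φ : ∀ x, HilbertModuleIso A (E.Fiber x) (F.Fiber x),
    Continuous (totalMap φ) ∧ Continuous (totalMap fun x => (φ x).symm)

theorem IsIso.refl (E : HilbertBundle A X) : IsIso E E :=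
  ⟨fun x => .refl A (E.Fiber x), continuous_id, continuous_id⟩

theorem IsIso.symm {E F : HilbertBundle A X} : IsIso E F → IsIso F E :=
  fun ⟨φ, h, h'⟩ => ⟨fun x => (φ x).symm, h', h⟩

theorem IsIso.trans {E F G : HilbertBundle A X} : IsIso E F → IsIso F G → IsIso E G :=
  fun ⟨φ, h, h'⟩ ⟨ψ, k, k'⟩ => ⟨fun x => (φ x).trans (ψ x), k.comp h, h'.comp k'⟩

/-- The bundle with zero fibers. -/
def zero (A : Type v) [CStarAlgebra A] [PartialOrder A] (X : Type u) [TopologicalSpace X] :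
    HilbertBundle A X :=
  letI : TopologicalSpace (FamilyTotal fun _ : X => PUnit.{max u v + 1}) :=
    .induced (fun p => p.base) inferInstance
  { Fiber := fun _ => PUnit
    continuous_base := continuous_induced_dom
    exists_trivialization := fun x₀ => ⟨Set.univ, isOpen_univ, trivial, PUnit, inferInstance,
      inferInstance, inferInstance, fun _ => .refl A PUnit,
      { continuous_toFun := by
          refine Continuous.prodMk ?_ (continuous_const (y := PUnit.unit))
          exact (Continuous.comp (g := fun p : FamilyTotal fun _ : X => PUnit.{max u v + 1} =>
            p.base) continuous_induced_dom continuous_subtype_val).subtype_mk _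
        continuous_invFun := by
          refine Continuous.subtype_mk (continuous_induced_rng.2 ?_) _
          exact continuous_subtype_val.comp continuous_fst }⟩ }

section Sum

variable [StarOrderedRing A]

/-- The total space of the direct sum has the topology of the fiber product of the total spaces. -/
abbrev sumTopology (E F : HilbertBundle A X) :
    TopologicalSpace (FamilyTotal fun x => HilbertSum A (E.Fiber x) (F.Fiber x)) :=
  .induced (fun p => ((⟨p.base, p.vec.1⟩, ⟨p.base, p.vec.2⟩) : E.Total × F.Total)) inferInstance

/-- The direct sum (Whitney sum) of two bundles. -/
def sum (E F : HilbertBundle A X) : HilbertBundle A X :=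
  letI := sumTopology E F
  { Fiber := fun x => HilbertSum A (E.Fiber x) (F.Fiber x)
    continuous_base := by
      have hd : Continuous (fun p : FamilyTotal fun x => HilbertSum A (E.Fiber x) (F.Fiber x) =>
          ((⟨p.base, p.vec.1⟩, ⟨p.base, p.vec.2⟩) : E.Total × F.Total)) :=
        continuous_induced_dom
      exact E.continuous_base.comp (continuous_fst.comp hd)
    exists_trivialization := fun x₀ => by
      obtain ⟨U, hU, hx, V, _, _, _, φ, hφ⟩ := E.exists_trivialization x₀
      obtain ⟨U', hU', hx', V', _, _, _, φ', hφ'⟩ := F.exists_trivialization x₀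
      have hl : Continuous fun q : (U ∩ U' : Set X) × HilbertSum A V V' =>
          ((⟨q.1, q.1.2.1⟩, q.2.1) : U × V) :=
        ((continuous_subtype_val.comp continuous_fst).subtype_mk _).prodMk
          (HilbertSum.continuous_fst.comp continuous_snd)
      have hr : Continuous fun q : (U ∩ U' : Set X) × HilbertSum A V V' =>
          ((⟨q.1, q.1.2.2⟩, q.2.2) : U' × V') :=
        ((continuous_subtype_val.comp continuous_fst).subtype_mk _).prodMk
          (HilbertSum.continuous_snd.comp continuous_snd)
      have hd : Continuous (fun p : FamilyTotal fun x => HilbertSum A (E.Fiber x) (F.Fiber x) =>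
          ((⟨p.base, p.vec.1⟩, ⟨p.base, p.vec.2⟩) : E.Total × F.Total)) :=
        continuous_induced_dom
      refine ⟨U ∩ U', hU.inter hU', ⟨hx, hx'⟩, HilbertSum A V V', inferInstance, inferInstance,
        inferInstance, fun x => HilbertSum.congr (φ ⟨x, x.2.1⟩) (φ' ⟨x, x.2.2⟩), ?_, ?_⟩
      · refine Continuous.prodMk ?_ ?_
        · exact (E.continuous_base.comp
            (continuous_fst.comp (hd.comp continuous_subtype_val))).subtype_mk _
        · have h1 := continuous_snd.comp (hφ.continuous_toFun.comp
            ((continuous_fst.comp (hd.comp continuous_subtype_val)).subtype_mk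
              fun (p : {p : FamilyTotal fun x => HilbertSum A (E.Fiber x) (F.Fiber x) //
                p.base ∈ U ∩ U'}) => p.2.1))
          have h2 := continuous_snd.comp (hφ'.continuous_toFun.comp
            ((continuous_snd.comp (hd.comp continuous_subtype_val)).subtype_mk
              fun (p : {p : FamilyTotal fun x => HilbertSum A (E.Fiber x) (F.Fiber x) //
                p.base ∈ U ∩ U'}) => p.2.2))
          exact HilbertSum.continuous_mk.comp (h1.prodMk h2)
      · refine Continuous.subtype_mk ?_ _
        have h1 := continuous_subtype_val.comp (hφ.continuous_invFun.comp hl)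
        have h2 := continuous_subtype_val.comp (hφ'.continuous_invFun.comp hr)
        exact continuous_induced_rng.2 (h1.prodMk h2) }

variable {E F G E' F' : HilbertBundle A X}

/-- The two components of a point of the total space of the direct sum. -/
def sumFst (p : (sum E F).Total) : E.Total := ⟨p.base, HilbertSum.fstHom (A := A) p.vec⟩

def sumSnd (p : (sum E F).Total) : F.Total := ⟨p.base, HilbertSum.sndHom (A := A) p.vec⟩

theorem isInducing_sum :
    Topology.IsInducing fun p : (sum E F).Total => (sumFst p, sumSnd p) := ⟨rfl⟩

theorem continuous_sum_fst : Continuous (sumFst (E := E) (F := F)) :=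
  continuous_fst.comp isInducing_sum.continuous

theorem continuous_sum_snd : Continuous (sumSnd (E := E) (F := F)) :=
  continuous_snd.comp isInducing_sum.continuous

theorem continuous_sum_rng {T : Type*} [TopologicalSpace T] {f : T → (sum E F).Total}
    (h₁ : Continuous fun t => sumFst (f t)) (h₂ : Continuous fun t => sumSnd (f t)) :
    Continuous f :=
  isInducing_sum.continuous_iff.2 (h₁.prodMk h₂)

theorem IsIso.sum : IsIso E E' → IsIso F F' → IsIso (sum E F) (sum E' F') :=
  fun ⟨φ, h, h'⟩ ⟨ψ, k, k'⟩ => ⟨fun x => HilbertSum.congr (φ x) (ψ x),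
    continuous_sum_rng (h.comp continuous_sum_fst) (k.comp continuous_sum_snd),
    continuous_sum_rng (h'.comp continuous_sum_fst) (k'.comp continuous_sum_snd)⟩

variable (E F G)

theorem isIso_comm : IsIso (sum E F) (sum F E) :=
  ⟨fun x => HilbertSum.comm A (E.Fiber x) (F.Fiber x),
    continuous_sum_rng continuous_sum_snd continuous_sum_fst,
    continuous_sum_rng continuous_sum_snd continuous_sum_fst⟩

theorem isIso_assoc : IsIso (sum (sum E F) G) (sum E (sum F G)) := by
  have h1 := (continuous_sum_fst (E := E) (F := F)).comp
    (continuous_sum_fst (E := sum E F) (F := G))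
  have h2 := (continuous_sum_snd (E := E) (F := F)).comp
    (continuous_sum_fst (E := sum E F) (F := G))
  have h3 := (continuous_sum_fst (E := F) (F := G)).comp
    (continuous_sum_snd (E := E) (F := sum F G))
  have h4 := (continuous_sum_snd (E := F) (F := G)).comp
    (continuous_sum_snd (E := E) (F := sum F G))
  exact ⟨fun x => HilbertSum.assoc A (E.Fiber x) (F.Fiber x) (G.Fiber x),
    continuous_sum_rng h1 (continuous_sum_rng h2 continuous_sum_snd),
    continuous_sum_rng (continuous_sum_rng continuous_sum_fst h3) h4⟩

theorem isIso_zero_sum : IsIso (sum (zero A X) E) E :=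
  ⟨fun x => HilbertSum.zeroSum A (E.Fiber x), continuous_sum_snd,
    continuous_sum_rng (continuous_induced_rng.2 E.continuous_base) continuous_id⟩

end Sum

/-! ### Continuous sections -/

/-- Continuity of a section can be checked in local trivializations. -/
theorem continuous_localRep {E : HilbertBundle A X} {s : ∀ x, E.Fiber x}
    (hs : Continuous fun x => (⟨x, s x⟩ : E.Total)) {U : Set X} {V : Type*} [NormedAddCommGroup V]
    [Module Aᵐᵒᵖ V] [HilbertModule A V] {φ : ∀ x : U, HilbertModuleIso A (E.Fiber x) V}
    (hφ : IsLocalTrivialization φ) : Continuous fun x : U => (φ x).toLinearEquiv (s x) :=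
  continuous_snd.comp (hφ.continuous_toFun.comp
    ((hs.comp continuous_subtype_val).subtype_mk fun x : U => x.2))

theorem continuousAt_of_localRep {E : HilbertBundle A X} {s : ∀ x, E.Fiber x} {U : Set X}
    (hU : IsOpen U) {x₀ : X} (hx : x₀ ∈ U) {V : Type*} [NormedAddCommGroup V]
    [Module Aᵐᵒᵖ V] [HilbertModule A V] {φ : ∀ x : U, HilbertModuleIso A (E.Fiber x) V}
    (hφ : IsLocalTrivialization φ) (h : Continuous fun x : U => (φ x).toLinearEquiv (s x)) :
    ContinuousAt (fun x => (⟨x, s x⟩ : E.Total)) x₀ := by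
  have h1 := continuous_subtype_val.comp (hφ.continuous_invFun.comp (continuous_id.prodMk h))
  have h2 : Continuous ((fun x => (⟨x, s x⟩ : E.Total)) ∘ (Subtype.val : U → X)) := by
    convert! h1 using 1
    funext x
    simp
  exact (hU.isOpenEmbedding_subtypeVal.continuousAt_iff (x := ⟨x₀, hx⟩)).1 h2.continuousAt

variable (E : HilbertBundle A X)

/-- The continuous sections of a bundle, with pointwise addition. -/
def sections : AddSubgroup (∀ x, E.Fiber x) where
  carrier := {s | Continuous fun x => (⟨x, s x⟩ : E.Total)}
  zero_mem' := continuous_iff_continuousAt.2 fun x₀ => by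
    obtain ⟨U, hU, hx, V, _, _, _, φ, hφ⟩ := E.exists_trivialization x₀
    exact continuousAt_of_localRep hU hx hφ (by simpa using continuous_const)
  add_mem' := fun {s t} hs ht => continuous_iff_continuousAt.2 fun x₀ => by
    obtain ⟨U, hU, hx, V, _, _, _, φ, hφ⟩ := E.exists_trivialization x₀
    refine continuousAt_of_localRep hU hx hφ ?_
    simp only [Pi.add_apply, map_add]
    exact (continuous_localRep hs hφ).add (continuous_localRep ht hφ)
  neg_mem' := fun {s} hs => continuous_iff_continuousAt.2 fun x₀ => by
    obtain ⟨U, hU, hx, V, _, _, _, φ, hφ⟩ := E.exists_trivialization x₀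
    refine continuousAt_of_localRep hU hx hφ ?_
    simp only [Pi.neg_apply, map_neg]
    exact (continuous_localRep hs hφ).neg

/-- The continuous sections form a right `C(X, A)`-module, with `(s • f) x = s x • f x`. -/
instance sectionsModule : Module C(X, A)ᵐᵒᵖ E.sections where
  smul f s := ⟨fun x => op (f.unop x) • s.1 x, continuous_iff_continuousAt.2 fun x₀ => by
    obtain ⟨U, hU, hx, V, _, _, _, φ, hφ⟩ := E.exists_trivialization x₀
    refine continuousAt_of_localRep hU hx hφ ?_
    have := HilbertModule.continuousSMul A V
    simp only [map_smul]
    exact (continuous_op.comp (f.unop.continuous.comp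
      (continuous_subtype_val (p := fun x => x ∈ U)))).smul (continuous_localRep s.2 hφ)⟩
  one_smul s := Subtype.ext (funext fun x => one_smul Aᵐᵒᵖ (s.1 x))
  mul_smul f g s := Subtype.ext (funext fun x =>
    mul_smul (op (f.unop x)) (op (g.unop x)) (s.1 x))
  smul_zero f := Subtype.ext (funext fun x => smul_zero (op (f.unop x)))
  smul_add f s t := Subtype.ext (funext fun x => smul_add (op (f.unop x)) (s.1 x) (t.1 x))
  add_smul f g s := Subtype.ext (funext fun x =>
    add_smul (op (f.unop x)) (op (g.unop x)) (s.1 x))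
  zero_smul s := Subtype.ext (funext fun x => zero_smul Aᵐᵒᵖ (s.1 x))

end HilbertBundle

/-! ### The K-group of finitely generated projective Hilbert module bundles -/

/-- A finitely generated projective Hilbert `A`-module bundle: all fibers are so. -/
structure FGPBundle (A : Type v) [CStarAlgebra A] [PartialOrder A] (X : Type u)
    [TopologicalSpace X] extends HilbertBundle A X where
  isFGP (x : X) : HilbertModule.IsFGP A (toHilbertBundle.Fiber x)

section BundleK

variable (A : Type v) [CStarAlgebra A] [PartialOrder A] (X : Type u) [TopologicalSpace X]

instance FGPBundle.setoid : Setoid (FGPBundle A X) where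
  r E F := HilbertBundle.IsIso E.toHilbertBundle F.toHilbertBundle
  iseqv := ⟨fun _ => .refl _, .symm, .trans⟩

/-- The set of isomorphism classes of finitely generated projective Hilbert `A`-module bundles. -/
def BundleClass : Type max u (v + 1) (u + 1) := Quotient (FGPBundle.setoid A X)

variable [StarOrderedRing A]

/-- The direct sum of two finitely generated projective bundles. -/
def FGPBundle.sum {A : Type v} [CStarAlgebra A] [PartialOrder A] [StarOrderedRing A] {X : Type u}
    [TopologicalSpace X] (E F : FGPBundle A X) : FGPBundle A X :=
  ⟨.sum E.toHilbertBundle F.toHilbertBundle, fun x => HilbertSum.isFGP (E.isFGP x) (F.isFGP x)⟩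

/-- Addition of isomorphism classes is given by the direct sum of bundles. -/
instance : Add (BundleClass A X) :=
  ⟨Quotient.map₂ FGPBundle.sum fun _ _ h _ _ k => HilbertBundle.IsIso.sum h k⟩

instance : Zero (BundleClass A X) := ⟨⟦⟨.zero A X, fun _ => HilbertModule.isFGP_punit⟩⟧⟩

instance : AddCommMonoid (BundleClass A X) where
  nsmul := nsmulRec
  add_assoc := by
    rintro ⟨E⟩ ⟨F⟩ ⟨G⟩
    exact Quotient.sound (HilbertBundle.isIso_assoc _ _ _)
  zero_add := by
    rintro ⟨E⟩
    exact Quotient.sound (HilbertBundle.isIso_zero_sum _)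
  add_zero := by
    rintro ⟨E⟩
    exact Quotient.sound ((HilbertBundle.isIso_comm _ _).trans (HilbertBundle.isIso_zero_sum _))
  add_comm := by
    rintro ⟨E⟩ ⟨F⟩
    exact Quotient.sound (HilbertBundle.isIso_comm _ _)

/-- The K-theory `K(X; A)` of `X` with coefficients in `A`. -/
abbrev BundleK : Type max u (v + 1) (u + 1) := Algebra.GrothendieckAddGroup (BundleClass A X)

variable {A X}

/-- The class of a bundle in `K(X; A)`. -/
def FGPBundle.toK (E : FGPBundle A X) : BundleK A X :=
  Algebra.GrothendieckAddGroup.of (Quotient.mk _ E : BundleClass A X)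

end BundleK

/-! ### `K₀` of a ring -/

/-- A finitely generated projective right module over a ring. -/
structure FGPModule (R : Type w) [Ring R] where
  carrier : Type w
  [addCommGroup : AddCommGroup carrier]
  [module : Module Rᵐᵒᵖ carrier]
  finite : Module.Finite Rᵐᵒᵖ carrier
  projective : Module.Projective Rᵐᵒᵖ carrier

attribute [instance] FGPModule.addCommGroup FGPModule.module FGPModule.finite FGPModule.projective

section KZero

variable (R : Type w) [Ring R]

instance FGPModule.setoid : Setoid (FGPModule R) where
  r M N := Nonempty (M.carrier ≃ₗ[Rᵐᵒᵖ] N.carrier)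
  iseqv := ⟨fun _ => ⟨.refl _ _⟩, fun ⟨e⟩ => ⟨e.symm⟩, fun ⟨e⟩ ⟨f⟩ => ⟨e.trans f⟩⟩

/-- The set of isomorphism classes of finitely generated projective right `R`-modules. -/
def ModuleClass : Type (w + 1) := Quotient (FGPModule.setoid R)

/-- Addition of isomorphism classes is given by the direct sum of modules. -/
instance : Add (ModuleClass R) :=
  ⟨Quotient.map₂ (fun M N => ⟨M.carrier × N.carrier, inferInstance, inferInstance⟩)
    fun _ _ ⟨e⟩ _ _ ⟨f⟩ => ⟨e.prodCongr f⟩⟩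

instance : Zero (ModuleClass R) := ⟨⟦⟨PUnit, inferInstance, inferInstance⟩⟧⟩

instance : AddCommMonoid (ModuleClass R) where
  nsmul := nsmulRec
  add_assoc := by
    rintro ⟨M⟩ ⟨N⟩ ⟨P⟩
    exact Quotient.sound ⟨LinearEquiv.prodAssoc Rᵐᵒᵖ M.carrier N.carrier P.carrier⟩
  zero_add := by
    rintro ⟨M⟩
    exact Quotient.sound ⟨LinearEquiv.uniqueProd⟩
  add_zero := by
    rintro ⟨M⟩
    exact Quotient.sound ⟨LinearEquiv.prodUnique⟩
  add_comm := by
    rintro ⟨M⟩ ⟨N⟩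
    exact Quotient.sound ⟨LinearEquiv.prodComm Rᵐᵒᵖ M.carrier N.carrier⟩

/-- `K₀(R)`, the Grothendieck group of finitely generated projective right `R`-modules. -/
abbrev KZero : Type (w + 1) := Algebra.GrothendieckAddGroup (ModuleClass R)

variable {R}

/-- The class of a module in `K₀(R)`. -/
def FGPModule.toK (M : FGPModule R) : KZero R :=
  Algebra.GrothendieckAddGroup.of (Quotient.mk _ M : ModuleClass R)

end KZero

/-! ### The minimal C⋆-norm on a tensor product -/

/-- The tensor product of representations of `A` and `B` on Hilbert spaces `H` and `K`: the linear
map sending `a ⊗ b` to the bounded operator `π a ⊗ ρ b` on the algebraic tensor product of `H` and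
`K`, which is a dense subspace of the Hilbert space tensor product. -/
def tensorRep {A : Type*} {B : Type*} [CStarAlgebra A] [CStarAlgebra B] {H K : Type*}
    [NormedAddCommGroup H] [InnerProductSpace ℂ H] [CompleteSpace H]
    [NormedAddCommGroup K] [InnerProductSpace ℂ K] [CompleteSpace K]
    (π : A →⋆ₐ[ℂ] (H →L[ℂ] H)) (ρ : B →⋆ₐ[ℂ] (K →L[ℂ] K)) :
    A ⊗[ℂ] B →ₗ[ℂ] ((H ⊗[ℂ] K) →L[ℂ] (H ⊗[ℂ] K)) :=
  TensorProduct.lift <| LinearMap.mk₂ ℂ (fun a b => TensorProduct.mapL (π a) (ρ b))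
    (fun _ _ _ => by rw [map_add, TensorProduct.mapL_add_left])
    (fun _ _ _ => by rw [map_smul, TensorProduct.mapL_smul_left])
    (fun _ _ _ => by rw [map_add, TensorProduct.mapL_add_right])
    (fun _ _ _ => by rw [map_smul, TensorProduct.mapL_smul_right])

/-- The minimal (spatial) C⋆-norm of an element of the algebraic tensor product of two C⋆-algebras:
the supremum of the operator norms of its images under all tensor products of representations. -/
def minTensorNorm {A : Type u} {B : Type v} [CStarAlgebra A] [CStarAlgebra B] (t : A ⊗[ℂ] B) :
    ℝ≥0∞ :=
  ⨆ (H : Type u) (_ : NormedAddCommGroup H) (_ : InnerProductSpace ℂ H) (_ : CompleteSpace H)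
    (K : Type v) (_ : NormedAddCommGroup K) (_ : InnerProductSpace ℂ K) (_ : CompleteSpace K)
    (π : A →⋆ₐ[ℂ] (H →L[ℂ] H)) (ρ : B →⋆ₐ[ℂ] (K →L[ℂ] K)), ‖tensorRep π ρ t‖ₑ

end

noncomputable section

theorem exists_finite_partition_of_unity {X : Type*} [TopologicalSpace X] [CompactSpace X]
    [T2Space X] {U : X → Set X} (hU : ∀ x, IsOpen (U x)) (hx : ∀ x, x ∈ U x) :
    ∃ (n : ℕ) (c : Fin n → X) (f : Fin n → C(X, ℝ)), (∀ i, tsupport (f i) ⊆ U (c i)) ∧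
      (∀ x, ∑ i, f i x = 1) ∧ ∀ i x, 0 ≤ f i x := by
  obtain ⟨t, ht⟩ := isCompact_univ.elim_finite_subcover U hU
    fun x _ => Set.mem_iUnion.2 ⟨x, hx x⟩
  let c : Fin t.card → X := fun i => t.equivFin.symm i
  have hcover : Set.univ ⊆ ⋃ i, U (c i) := fun x hx => by
    obtain ⟨y, hy, hxy⟩ := Set.mem_iUnion₂.1 (ht hx)
    exact Set.mem_iUnion.2 ⟨t.equivFin ⟨y, hy⟩, by simpa [c] using hxy⟩
  obtain ⟨f, hf, hsum, hpos, -⟩ :=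
    exists_continuous_sum_one_of_isOpen_isCompact (fun i => hU (c i)) isCompact_univ hcover
  exact ⟨t.card, c, f, hf, fun x => by simpa using hsum (Set.mem_univ x),
    fun i x => (hpos i x).1⟩

/-- The isomorphism of Grothendieck groups induced by an isomorphism of monoids. -/
def grothendieckAddGroupCongr {M N : Type*} [AddCommMonoid M] [AddCommMonoid N] (e : M ≃+ N) :
    Algebra.GrothendieckAddGroup M ≃+ Algebra.GrothendieckAddGroup N :=
  (AddLocalization.addMonoidOf (⊤ : AddSubmonoid M)).addEquivOfAddEquiv
    (AddLocalization.addMonoidOf (⊤ : AddSubmonoid N)) (j := e)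
    ((AddMonoidHom.mrange_eq_map e.toAddMonoidHom).symm.trans
      (AddMonoidHom.mrange_eq_top_of_surjective _ e.surjective))

theorem grothendieckAddGroupCongr_of {M N : Type*} [AddCommMonoid M] [AddCommMonoid N]
    (e : M ≃+ N) (m : M) : grothendieckAddGroupCongr e (Algebra.GrothendieckAddGroup.of m) =
      Algebra.GrothendieckAddGroup.of (e m) :=
  AddSubmonoid.LocalizationMap.addEquivOfAddEquiv_eq _ _ m

/-! ### Continuous families of projections in C⋆-algebras -/

section RelativeUnit

/-- `t` is invertible relative to `p` and `q`, which are then idempotents: left multiplication by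
`t` restricts to an isomorphism from the range of `p` onto the range of `q` (and `t` vanishes on
the range of `1 - p`). -/
structure IsRelativeUnit {R : Type*} [Mul R] (p q t : R) : Prop where
  mul_eq_self : t * p = t
  eq_self_mul : q * t = t
  exists_inverse : ∃ s, s * t = p ∧ t * s = q

theorem isRelativeUnit_mul_of_isUnit {R : Type*} [Ring R] {p q : R} (hp : IsIdempotentElem p)
    (hq : IsIdempotentElem q) (h : IsUnit (q * p + (1 - q) * (1 - p))) :
    IsRelativeUnit p q (q * p) := by
  have hzp : (q * p + (1 - q) * (1 - p)) * p = q * p := by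
    rw [add_mul, mul_assoc (1 - q), hp.one_sub_mul_self, mul_zero, add_zero, mul_assoc, hp.eq]
  have hqz : q * (q * p + (1 - q) * (1 - p)) = q * p := by
    rw [mul_add, ← mul_assoc q (1 - q), hq.mul_one_sub_self, zero_mul, add_zero, ← mul_assoc, hq.eq]
  obtain ⟨z, hz⟩ := h
  rw [← hz] at hzp hqz
  refine ⟨by rw [mul_assoc, hp.eq], by rw [← mul_assoc, hq.eq], ↑z⁻¹ * q, ?_, ?_⟩
  · rw [mul_assoc, ← mul_assoc q, hq.eq, ← hzp, z.inv_mul_cancel_left]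
  · rw [← hqz, ← mul_assoc, z.mul_inv_cancel_right, hq.eq]

namespace IsRelativeUnit

theorem map {R S F : Type*} [Mul R] [Mul S] [FunLike F R S] [MulHomClass F R S] {p q t : R}
    (h : IsRelativeUnit p q t) (f : F) : IsRelativeUnit (f p) (f q) (f t) where
  mul_eq_self := by rw [← map_mul, h.mul_eq_self]
  eq_self_mul := by rw [← map_mul, h.eq_self_mul]
  exists_inverse := by
    obtain ⟨s, hst, hts⟩ := h.exists_inverse
    exact ⟨f s, by rw [← map_mul, hst], by rw [← map_mul, hts]⟩

variable {M : Type*} [Ring M] [StarRing M] {p q t : M}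

theorem mul_star_eq_star (h : IsRelativeUnit p q t) (hp : IsSelfAdjoint p) :
    p * star t = star t := by
  simpa [hp.star_eq] using congr(star $h.mul_eq_self)

theorem commute_star_mul_self_add (h : IsRelativeUnit p q t) (hp : IsSelfAdjoint p) :
    Commute p (star t * t + (1 - p)) := by
  refine Commute.add_right ?_ ((Commute.one_right p).sub_right (Commute.refl p))
  rw [commute_iff_eq, ← mul_assoc, h.mul_star_eq_star hp, mul_assoc, h.mul_eq_self]

theorem isUnit_star_mul_self_add (h : IsRelativeUnit p q t) (hp : IsStarProjection p)
    (hq : IsSelfAdjoint q) : IsUnit (star t * t + (1 - p)) := by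
  obtain ⟨s, hst, hts⟩ := h.exists_inverse
  have hq_mul : star t * q = star t := by simpa [hq.star_eq] using congr(star $h.eq_self_mul)
  have hp2 := hp.isIdempotentElem
  let r := p * s
  have hpr : p * r = r := by rw [← mul_assoc, hp2.eq]
  have hrt : r * t = p := by rw [mul_assoc, hst, hp2.eq]
  have htr : t * r = q := by rw [← mul_assoc, h.mul_eq_self, hts]
  have hcancel : star t * t * (r * star r) = p := by
    rw [mul_assoc, ← mul_assoc t, htr, ← mul_assoc, hq_mul, ← star_mul, hrt,
      hp.isSelfAdjoint.star_eq]
  have hright : (star t * t + (1 - p)) * (r * star r + (1 - p)) = 1 := by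
    have h₁ : star t * t * (1 - p) = 0 := by
      rw [mul_assoc, mul_sub, mul_one, h.mul_eq_self, sub_self, mul_zero]
    have h₂ : (1 - p) * (r * star r) = 0 := by
      rw [← mul_assoc, sub_mul, one_mul, hpr, sub_self, zero_mul]
    rw [add_mul, mul_add, mul_add, hcancel, h₁, h₂, hp2.one_sub.eq]
    abel
  have hleft : (r * star r + (1 - p)) * (star t * t + (1 - p)) = 1 := by
    simpa [hp.isSelfAdjoint.star_eq] using congr(star $hright)
  exact ⟨⟨_, _, hright, hleft⟩, rfl⟩

-- `w` stands for `(star t * t + (1 - p)) ^ (-1 / 2)`, which makes `t * w` the polar part of `t`.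
theorem star_mul_mul_mul_of_invSqrt (h : IsRelativeUnit p q t) (hp : IsStarProjection p) {w : M}
    (hw : IsSelfAdjoint w) (hpw : Commute p w)
    (hwc : Commute w (star t * t + (1 - p))) (hinv : w * w * (star t * t + (1 - p)) = 1) :
    star (t * w) * (t * w) = p := by
  have hpc : p * (star t * t + (1 - p)) = star t * t := by
    rw [mul_add, hp.isIdempotentElem.mul_one_sub_self, add_zero, ← mul_assoc,
      h.mul_star_eq_star hp.isSelfAdjoint]
  calc star (t * w) * (t * w) = w * (star t * t) * w := by
        rw [star_mul, hw.star_eq]; simp only [mul_assoc]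
    _ = p * (w * ((star t * t + (1 - p)) * w)) := by
        nth_rw 1 [← hpc]
        rw [← mul_assoc, ← hpw.eq]
        simp only [mul_assoc]
    _ = p * (w * w * (star t * t + (1 - p))) := by rw [← hwc.eq, mul_assoc]
    _ = p := by rw [hinv, mul_one]

theorem mul_mul_star_mul_of_isUnit (h : IsRelativeUnit p q t) (hq : IsSelfAdjoint q) {w : M}
    (hpw : Commute p w) (hw : IsUnit w) (hiso : star (t * w) * (t * w) = p) :
    t * w * star (t * w) = q := by
  obtain ⟨s, -, hts⟩ := h.exists_inverse
  have hstar_q : star (t * w) * q = star (t * w) := by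
    simpa [hq.star_eq, mul_assoc] using congr(star (($h.eq_self_mul) * w))
  have hfix : t * w * star (t * w) * t = t := hw.mul_right_cancel <| by
    rw [mul_assoc _ t, mul_assoc (t * w), hiso, mul_assoc, ← hpw.eq, ← mul_assoc, h.mul_eq_self]
  calc t * w * star (t * w) = t * w * star (t * w) * (t * s) := by
        rw [hts, mul_assoc (t * w), hstar_q]
    _ = q := by rw [← mul_assoc, hfix, hts]

end IsRelativeUnit

end RelativeUnit

section Kaplansky

variable {M : Type*} [Ring M] [StarRing M] {e : M}

theorem idempotent_mul_one_add_star_mul_self (he : IsIdempotentElem e) :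
    e * (1 + star (star e - e) * (star e - e)) = e * star e * e := by
  have h : e * (1 + star (star e - e) * (star e - e)) =
      e + e * e * star e - e * e * e - e * (star e * star e) + e * star e * e := by
    rw [star_sub, star_star]; noncomm_ring
  rw [h, he.star.eq, he.eq, he.eq]
  abel

theorem one_add_star_mul_self_mul_idempotent (he : IsIdempotentElem e) :
    (1 + star (star e - e) * (star e - e)) * e = e * star e * e := by
  have h : (1 + star (star e - e) * (star e - e)) * e =
      e + e * star e * e - e * (e * e) - star e * star e * e + star e * (e * e) := by
    rw [star_sub, star_star]; noncomm_ring
  rw [h, he.star.eq, he.eq, he.eq]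
  abel

/-- Kaplansky's formula for a projection with the same range as `e`. -/
theorem isStarProjection_mul_star_mul_inv (he : IsIdempotentElem e) {k : Mˣ}
    (hk : (k : M) = 1 + star (star e - e) * (star e - e)) :
    IsStarProjection (e * star e * ↑k⁻¹) ∧ e * star e * ↑k⁻¹ * e = e := by
  have hke : ↑k * e = e * star e * e := by rw [hk, one_add_star_mul_self_mul_idempotent he]
  have hek : e * ↑k = e * star e * e := by rw [hk, idempotent_mul_one_add_star_mul_self he]
  have hk_star : star k = k := Units.ext (by simp [hk])
  have hinv_star : star (↑k⁻¹ : M) = ↑k⁻¹ := by rw [← Units.coe_star_inv, hk_star]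
  have hcomm : Commute (k : M) e := hke.trans hek.symm
  have hcomm_star : Commute (k : M) (star e) := by
    simpa only [← Units.coe_star, hk_star] using hcomm.star_star
  have hfix : e * star e * ↑k⁻¹ * e = e := by
    rw [mul_assoc, hcomm.units_inv_left.eq, ← mul_assoc, ← hek, k.mul_inv_cancel_right]
  refine ⟨⟨?_, ?_⟩, hfix⟩
  · rw [IsIdempotentElem, ← mul_assoc, ← mul_assoc, hfix]
  · rw [isSelfAdjoint_iff, star_mul, star_mul, star_star, hinv_star, ← mul_assoc,
      hcomm.units_inv_left.eq, mul_assoc, hcomm_star.units_inv_left.eq, mul_assoc]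

end Kaplansky

section ContinuousFamilies

variable {M : Type*} [CStarAlgebra M] {Y : Type*} [TopologicalSpace Y]

theorem exists_continuous_partialIsometry_of_isRelativeUnit {T P Q : Y → M} (hT : Continuous T)
    (hP : Continuous P) (hp : ∀ y, IsStarProjection (P y)) (hq : ∀ y, IsSelfAdjoint (Q y))
    (h : ∀ y, IsRelativeUnit (P y) (Q y) (T y)) :
    ∃ U : Y → M, Continuous U ∧ ∀ y, star (U y) * U y = P y ∧ U y * star (U y) = Q y := by
  let := CStarAlgebra.spectralOrder M
  have := CStarAlgebra.spectralOrderedRing M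
  let c : Y → M := fun y => star (T y) * T y + (1 - P y)
  have hc : ∀ y, IsStrictlyPositive (c y) := fun y =>
    ((h y).isUnit_star_mul_self_add (hp y) (hq y)).isStrictlyPositive
      (add_nonneg (star_mul_self_nonneg _) (hp y).one_sub.nonneg)
  let w : Y → M := fun y => c y ^ (-(1 / 2) : ℝ)
  have hw : Continuous w := by
    have hc_cont : Continuous c := by fun_prop
    exact (CFC.continuousOn_rpow _).comp_continuous hc_cont hc
  have hw_sa : ∀ y, IsSelfAdjoint (w y) := fun y => CFC.rpow_nonneg.isSelfAdjoint
  have hw_comm : ∀ y z, Commute (c y) z → Commute (w y) z := fun y z hz => hz.cfc_nnreal _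
  have hpw : ∀ y, Commute (P y) (w y) := fun y =>
    (hw_comm y _ ((h y).commute_star_mul_self_add (hp y).isSelfAdjoint).symm).symm
  have hinv : ∀ y, w y * w y * c y = 1 := fun y => by
    have := CFC.rpow_neg_mul_rpow 1 (hc y)
    rw [CFC.rpow_one _ (hc y).nonneg] at this
    rw [← CFC.rpow_add (hc y).isUnit, ← this]
    norm_num
  have hiso : ∀ y, star (T y * w y) * (T y * w y) = P y := fun y =>
    (h y).star_mul_mul_mul_of_invSqrt (hp y) (hw_sa y) (hpw y) (hw_comm y _ (Commute.refl _))
      (hinv y)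
  exact ⟨fun y => T y * w y, hT.mul hw, fun y => ⟨hiso y,
    (h y).mul_mul_star_mul_of_isUnit (hq y) (hpw y) ((hc y).rpow _ _).isUnit
      (hiso y)⟩⟩

theorem exists_continuous_isStarProjection_of_isIdempotentElem {E : Y → M} (hE : Continuous E)
    (he : ∀ y, IsIdempotentElem (E y)) :
    ∃ P : Y → M, Continuous P ∧ ∀ y, IsStarProjection (P y) ∧ E y * P y = P y ∧
      P y * E y = E y := by
  let := CStarAlgebra.spectralOrder M
  have := CStarAlgebra.spectralOrderedRing M
  have hk_unit : ∀ y, IsUnit (1 + star (star (E y) - E y) * (star (E y) - E y)) := fun y =>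
    CStarAlgebra.isUnit_of_le 1 (le_add_of_nonneg_right (star_mul_self_nonneg _))
  choose k hk using hk_unit
  have hk_cont : Continuous k := by
    refine Units.isOpenEmbedding_val.isInducing.continuous_iff.2 ?_
    simp only [Function.comp_def, hk]
    fun_prop
  have : Continuous fun y => (↑(k y)⁻¹ : M) := Units.continuous_val.comp hk_cont.inv
  refine ⟨fun y => E y * star (E y) * ↑(k y)⁻¹, by fun_prop, fun y => ?_⟩
  obtain ⟨hproj, hfix⟩ := isStarProjection_mul_star_mul_inv (he y) (hk y)
  exact ⟨hproj, by simp only [← mul_assoc, (he y).eq], hfix⟩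

end ContinuousFamilies

/-! ### Right modules and matrices -/

open scoped Matrix

section RightModules

variable {S : Type*} [Ring S]

instance : Module.Finite Sᵐᵒᵖ S := Module.Finite.equiv (opLinearEquiv Sᵐᵒᵖ).symm

instance : Module.Free Sᵐᵒᵖ S := Module.Free.of_equiv (opLinearEquiv Sᵐᵒᵖ).symm

variable {ι κ : Type*} [DecidableEq ι]

/-- The matrix of a linear map between free right modules, acting on column vectors. -/
def colMatrix (M : (ι → S) →ₗ[Sᵐᵒᵖ] (κ → S)) : Matrix κ ι S :=
  .of fun i j => M (Pi.single j 1) i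

theorem colMatrix_mulVec [Fintype ι] (M : (ι → S) →ₗ[Sᵐᵒᵖ] (κ → S)) (y : ι → S) :
    colMatrix M *ᵥ y = M y := by
  have h : Matrix.mulVecBilin S Sᵐᵒᵖ (colMatrix M) = M :=
    LinearMap.pi_ext' fun j => LinearMap.ext_ring_op (Matrix.mulVec_single_one (colMatrix M) j)
  exact DFunLike.congr_fun h y

theorem colMatrix_injective [Finite ι] :
    Function.Injective (colMatrix : ((ι → S) →ₗ[Sᵐᵒᵖ] (κ → S)) → Matrix κ ι S) := by
  have := Fintype.ofFinite ι
  exact fun M N h => LinearMap.ext fun y => by rw [← colMatrix_mulVec, h, colMatrix_mulVec]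

theorem colMatrix_comp [Fintype κ] [DecidableEq κ] {μ : Type*}
    (N : (κ → S) →ₗ[Sᵐᵒᵖ] (μ → S)) (M : (ι → S) →ₗ[Sᵐᵒᵖ] (κ → S)) :
    colMatrix (N ∘ₗ M) = colMatrix N * colMatrix M :=
  Matrix.ext_col fun j => (colMatrix_mulVec N (M (Pi.single j 1))).symm

theorem isRelativeUnit_colMatrix [Fintype ι] {M N : Type*} [AddCommGroup M]
    [Module Sᵐᵒᵖ M] [AddCommGroup N] [Module Sᵐᵒᵖ N] {i : M →ₗ[Sᵐᵒᵖ] (ι → S)}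
    {r : (ι → S) →ₗ[Sᵐᵒᵖ] M} (hr : r ∘ₗ i = .id) {j : N →ₗ[Sᵐᵒᵖ] (ι → S)}
    {k : (ι → S) →ₗ[Sᵐᵒᵖ] N} (hk : k ∘ₗ j = .id)
    (e : M ≃ₗ[Sᵐᵒᵖ] N) :
    IsRelativeUnit (colMatrix (i ∘ₗ r)) (colMatrix (j ∘ₗ k)) (colMatrix (j ∘ₗ e ∘ₗ r)) := by
  replace hr (m : M) : r (i m) = m := DFunLike.congr_fun hr m
  replace hk (n : N) : k (j n) = n := DFunLike.congr_fun hk n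
  refine ⟨?_, ?_, colMatrix (i ∘ₗ e.symm ∘ₗ k), ?_, ?_⟩ <;>
    rw [← colMatrix_comp] <;>
    exact congrArg colMatrix (LinearMap.ext fun y => by simp [hr, hk])

end RightModules

/-! ### The standard Hilbert module and frames -/

namespace HilbertModule

/-- The standard Hilbert module `A ^ ι`.  Mathlib's Hilbert modules are left modules, so right
modules over `A` appear as modules over `Aᵐᵒᵖ`. -/
abbrev Column (A : Type*) [CStarAlgebra A] (ι : Type*) : Type _ := WithCStarModule Aᵐᵒᵖ (ι → Aᵐᵒᵖ)

variable {A : Type*} [CStarAlgebra A] [PartialOrder A] {ι κ : Type*} [Fintype ι]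

/-- The entries of an element of the standard Hilbert module. -/
def Column.entries : Column A ι ≃L[Aᵐᵒᵖ] (ι → A) :=
  (WithCStarModule.equivL Aᵐᵒᵖ).trans
    (.piCongrRight fun _ => (opContinuousLinearEquiv Aᵐᵒᵖ).symm)

theorem Column.inner_eq [StarOrderedRing A] (v w : Column A ι) :
    inner Aᵐᵒᵖ v w = op (star (entries v) ⬝ᵥ entries w) := by
  rw [dotProduct, Finset.op_sum]
  rfl

section InnerProduct

variable {V W : Type*}
  [NormedAddCommGroup V] [Module Aᵐᵒᵖ V] [HilbertModule A V]
  [NormedAddCommGroup W] [Module Aᵐᵒᵖ W] [HilbertModule A W]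

/-- The inner product with a fixed first argument. -/
def innerRight (v : V) : V →ₗ[Aᵐᵒᵖ] A where
  toFun w := inner A v w
  map_add' := inner_add_right v
  map_smul' a w := inner_op_smul_right v w a.unop

theorem inner_zero_right (v : V) : inner A v (0 : V) = 0 := map_zero (innerRight v)

theorem inner_sum_right {κ : Type*} (s : Finset κ) (v : V) (w : κ → V) :
    inner A v (∑ k ∈ s, w k) = ∑ k ∈ s, inner A v (w k) :=
  map_sum (innerRight v) w s

theorem ext_inner {v w : V} (h : ∀ z : V, inner A z v = inner A z w) : v = w := by
  rw [← sub_eq_zero, ← inner_self_eq_zero (A := A)]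
  exact (map_sub (innerRight (v - w)) v w).trans (sub_eq_zero.2 (h _))

/-- A frame of a Hilbert `A`-module indexed by a finite type `ι`: an adjointable isometric
embedding into `A ^ ι`, together with its adjoint. -/
structure Frame (A : Type*) [CStarAlgebra A] [PartialOrder A] (V : Type*)
    [NormedAddCommGroup V] [Module Aᵐᵒᵖ V] [HilbertModule A V] (ι : Type*) [Fintype ι] where
  coord : V →ₗ[Aᵐᵒᵖ] (ι → A)
  synth : (ι → A) →ₗ[Aᵐᵒᵖ] V
  synth_coord (v : V) : synth (coord v) = v
  inner_synth (v : V) (y : ι → A) : inner A v (synth y) = star (coord v) ⬝ᵥ y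

theorem IsFGP.exists_frame (h : IsFGP A V) : ∃ n : ℕ, Nonempty (Frame A V (Fin n)) := by
  obtain ⟨n, i, hi, hi'⟩ := h
  choose r hr using hi'
  have inner_r (y w) : inner A w (r y) = star (i w) ⬝ᵥ y := by
    have h := hr y w
    simp only [mul_sub, Finset.sum_sub_distrib, hi] at h
    exact (sub_eq_zero.1 h).symm
  refine ⟨n, ⟨⟨i, ⟨⟨r, fun y z => ?_⟩, fun a y => ?_⟩, fun v => ?_, fun v y => inner_r y v⟩⟩⟩ <;>
    refine ext_inner (A := A) fun w => ?_
  · rw [inner_add_right, inner_r, inner_r, inner_r, dotProduct_add]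
  · obtain ⟨a, rfl⟩ := op_surjective a
    rw [RingHom.id_apply, inner_op_smul_right, inner_r, inner_r, dotProduct_smul]
    rfl
  · exact (inner_r (i v) w).trans (hi w v)

namespace Frame

variable (F : Frame A V ι)

theorem inner_eq (v w : V) : inner A v w = star (F.coord v) ⬝ᵥ F.coord w := by
  rw [← F.inner_synth, F.synth_coord]

/-- Transport of a frame along an isomorphism. -/
def comap (φ : HilbertModuleIso A W V) : Frame A W ι where
  coord := F.coord ∘ₗ φ.toLinearEquiv.toLinearMap
  synth := φ.toLinearEquiv.symm.toLinearMap ∘ₗ F.synth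
  synth_coord v := by simp [F.synth_coord]
  inner_synth v y := by
    rw [← φ.inner_map]
    simp [F.inner_synth]

/-- The frame with additional zero coordinates, indexed by a larger type. -/
def extend [Fintype κ] (e : ι ↪ κ) : Frame A V κ where
  coord :=
    { toFun := fun v => Function.extend e (F.coord v) 0
      map_add' := fun v w => by rw [map_add, ← Function.extend_add, add_zero]
      map_smul' := fun a v => by
        rw [map_smul, RingHom.id_apply, ← Function.extend_smul, smul_zero] }
  synth := F.synth ∘ₗ LinearMap.funLeft Aᵐᵒᵖ A e
  synth_coord v := (congrArg F.synth (Function.extend_comp e.injective _ _)).trans (F.synth_coord v)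
  inner_synth v y := by
    rw [LinearMap.comp_apply, F.inner_synth]
    refine Fintype.sum_of_injective e e.injective _ _ (fun k hk => ?_) fun i => ?_
    · simp [Function.extend_apply' _ _ _ hk]
    · simp [e.injective.extend_apply, LinearMap.funLeft]

theorem isFGP (F : Frame A V ι) : IsFGP A V := by
  let G := F.extend (Fintype.equivFin ι).toEmbedding
  refine ⟨Fintype.card ι, G.coord, fun v w => (G.inner_eq v w).symm,
    fun y => ⟨G.synth y, fun w => ?_⟩⟩
  have h : star (G.coord w) ⬝ᵥ (y - G.coord (G.synth y)) = 0 := by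
    rw [dotProduct_sub, ← G.inner_synth, ← G.inner_eq, sub_self]
  exact h

section Continuity

variable [StarOrderedRing A]

theorem norm_entries_symm_coord (v : V) : ‖Column.entries.symm (F.coord v)‖ = ‖v‖ := by
  rw [CStarModule.norm_eq_sqrt_norm_inner_self (A := Aᵐᵒᵖ), Column.inner_eq, norm_op,
    ContinuousLinearEquiv.apply_symm_apply, ← F.inner_eq, ← norm_eq_sqrt]

theorem norm_synth_le (y : ι → A) : ‖F.synth y‖ ≤ ‖Column.entries.symm y‖ := by
  have h : ‖F.synth y‖ ^ 2 ≤ ‖F.synth y‖ * ‖Column.entries.symm y‖ := by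
    rw [norm_eq_sqrt (A := A), Real.sq_sqrt (norm_nonneg _), ← norm_eq_sqrt, F.inner_synth,
      ← F.norm_entries_symm_coord]
    have := CStarModule.norm_inner_le (A := Aᵐᵒᵖ) (Column A ι)
      (x := Column.entries.symm (F.coord (F.synth y))) (y := Column.entries.symm y)
    rwa [Column.inner_eq, norm_op, ContinuousLinearEquiv.apply_symm_apply,
      ContinuousLinearEquiv.apply_symm_apply] at this
  nlinarith [norm_nonneg (F.synth y), norm_nonneg (Column.entries.symm y)]

theorem continuous_coord : Continuous F.coord := by
  have h : Continuous fun v => Column.entries.symm (F.coord v) :=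
    AddMonoidHomClass.continuous_of_bound
      (Column.entries.symm.toLinearEquiv.toLinearMap ∘ₗ F.coord) 1 fun v =>
        (F.norm_entries_symm_coord v).le.trans_eq (one_mul _).symm
  simpa [Function.comp_def] using Column.entries.continuous.comp h

theorem continuous_synth : Continuous F.synth := by
  have h : Continuous fun v => F.synth (Column.entries v) :=
    AddMonoidHomClass.continuous_of_bound
      (F.synth ∘ₗ Column.entries.toLinearEquiv.toLinearMap) 1 fun v => by
        simpa using F.norm_synth_le (Column.entries v)
  simpa [Function.comp_def] using h.comp Column.entries.symm.continuous

end Continuity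

section Projection

variable [DecidableEq ι]

/-- The matrix of the projection of `A ^ ι` onto the range of the coordinate map. -/
def proj : Matrix ι ι A := colMatrix (F.coord ∘ₗ F.synth)

theorem proj_mulVec (y : ι → A) : F.proj *ᵥ y = F.coord (F.synth y) := colMatrix_mulVec _ y

theorem proj_mulVec_coord (v : V) : F.proj *ᵥ F.coord v = F.coord v := by
  rw [proj_mulVec, F.synth_coord]

theorem synth_proj_mulVec (y : ι → A) : F.synth (F.proj *ᵥ y) = F.synth y := by
  rw [proj_mulVec, F.synth_coord]

theorem isStarProjection_proj : IsStarProjection F.proj := by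
  constructor
  · refine Matrix.mulVec_injective (funext fun y => ?_)
    rw [← Matrix.mulVec_mulVec, F.proj_mulVec (F.proj *ᵥ y), F.synth_proj_mulVec, F.proj_mulVec]
  · have symmetric (y z : ι → A) : star y ⬝ᵥ (F.proj *ᵥ z) = star (F.proj *ᵥ y) ⬝ᵥ z := by
      rw [proj_mulVec, proj_mulVec, ← F.inner_synth, Matrix.star_dotProduct, ← F.inner_synth,
        star_inner]
    refine Matrix.IsHermitian.ext fun i j => ?_
    have h := symmetric (Pi.single i 1) (Pi.single j 1)
    rw [Matrix.star_mulVec, ← Matrix.dotProduct_mulVec] at h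
    simpa [← Pi.single_star] using h.symm

end Projection

end Frame

end InnerProduct

end HilbertModule

/-! ### Frames of bundles -/

namespace HilbertBundle

variable {A : Type v} [CStarAlgebra A] [PartialOrder A] {X : Type u} [TopologicalSpace X]
  {E : HilbertBundle A X}

/-- A continuous frame of a bundle over a subset of the base. -/
structure FrameOn (E : HilbertBundle A X) (U : Set X) (ι : Type*) [Fintype ι] where
  fiber (x : U) : HilbertModule.Frame A (E.Fiber x) ι
  continuous_coord : Continuous fun p : {p : E.Total // p.base ∈ U} =>
    (fiber ⟨p.1.base, p.2⟩).coord p.1.vec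
  continuous_synth : Continuous fun q : U × (ι → A) =>
    (⟨q.1, (fiber q.1).synth q.2⟩ : E.Total)

/-- A continuous frame of a bundle, indexed by a finite type: an embedding of the bundle into the
trivial bundle with fiber `A ^ ι`, together with the adjoint of this embedding. -/
structure Frame (E : HilbertBundle A X) (ι : Type*) [Fintype ι] where
  fiber (x : X) : HilbertModule.Frame A (E.Fiber x) ι
  continuous_coord : Continuous fun p : E.Total => (fiber p.base).coord p.vec
  continuous_synth : Continuous fun q : X × (ι → A) =>
    (⟨q.1, (fiber q.1).synth q.2⟩ : E.Total)

/-- The frame over the domain of a local trivialization given by a frame of the typical fiber. -/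
def FrameOn.ofTrivialization [StarOrderedRing A] {U : Set X} {V : Type*}
    [NormedAddCommGroup V] [Module Aᵐᵒᵖ V] [HilbertModule A V]
    {φ : ∀ x : U, HilbertModuleIso A (E.Fiber x) V} (hφ : IsLocalTrivialization φ)
    {ι : Type*} [Fintype ι] (F : HilbertModule.Frame A V ι) : FrameOn E U ι where
  fiber x := F.comap (φ x)
  continuous_coord := F.continuous_coord.comp (continuous_snd.comp hφ.continuous_toFun)
  continuous_synth := continuous_subtype_val.comp (hφ.continuous_invFun.comp
    (continuous_fst.prodMk (F.continuous_synth.comp continuous_snd)))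

theorem _root_.FGPBundle.exists_frameOn [StarOrderedRing A] (E : FGPBundle A X) (x₀ : X) :
    ∃ U : Set X, IsOpen U ∧ x₀ ∈ U ∧ ∃ n : ℕ, Nonempty (FrameOn E.toHilbertBundle U (Fin n)) := by
  obtain ⟨U, hU, hx, V, _, _, _, φ, hφ⟩ := E.exists_trivialization x₀
  obtain ⟨n, ⟨F⟩⟩ := (E.isFGP x₀).exists_frame
  exact ⟨U, hU, hx, n, ⟨.ofTrivialization hφ (F.comap (φ ⟨x₀, hx⟩).symm)⟩⟩

section Continuity

variable {T : Type*} [TopologicalSpace T]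

theorem continuous_of_continuous_preimage_of_tsupport_subset {Z : Type*} [TopologicalSpace Z]
    {b : T → X} (hb : Continuous b) {U : Set X} (hU : IsOpen U) {s : X → ℝ} (hs : tsupport s ⊆ U)
    {f g : T → Z} (hf : Continuous fun t : {t // b t ∈ U} => f t) (hg : Continuous g)
    (h : ∀ t, s (b t) = 0 → f t = g t) : Continuous f := by
  refine continuous_iff_continuousAt.2 fun t => ?_
  by_cases ht : b t ∈ U
  · exact ((hU.preimage hb).isOpenEmbedding_subtypeVal.continuousAt_iff (x := ⟨t, ht⟩)).1
      hf.continuousAt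
  · have hn : (tsupport s)ᶜ ∈ nhds (b t) :=
      (isClosed_tsupport s).isOpen_compl.mem_nhds fun h => ht (hs h)
    refine hg.continuousAt.congr ?_
    filter_upwards [hb.continuousAt hn] with t' ht'
    exact (h t' (image_eq_zero_of_notMem_tsupport ht')).symm

theorem _root_.IsLocalTrivialization.continuous_total_iff {U : Set X} {V : Type*}
    [NormedAddCommGroup V] [Module Aᵐᵒᵖ V] [HilbertModule A V]
    {φ : ∀ x : U, HilbertModuleIso A (E.Fiber x) V} (hφ : IsLocalTrivialization φ)
    {b : T → U} (hb : Continuous b) {v : ∀ t, E.Fiber (b t)} :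
    (Continuous fun t => (⟨b t, v t⟩ : E.Total)) ↔
      Continuous fun t => (φ (b t)).toLinearEquiv (v t) := by
  refine ⟨fun h => continuous_snd.comp (hφ.continuous_toFun.comp
    (h.subtype_mk fun t => (b t).2)), fun h => ?_⟩
  simpa [Function.comp_def] using
    continuous_subtype_val.comp (hφ.continuous_invFun.comp (hb.prodMk h))

theorem continuous_zero_total {b : T → X} (hb : Continuous b) :
    Continuous fun t => (⟨b t, 0⟩ : E.Total) :=
  (E.sections.zero_mem : Continuous fun x => (⟨x, 0⟩ : E.Total)).comp hb

theorem continuous_add_total {b : T → X} {v w : ∀ t, E.Fiber (b t)}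
    (hv : Continuous fun t => (⟨b t, v t⟩ : E.Total))
    (hw : Continuous fun t => (⟨b t, w t⟩ : E.Total)) :
    Continuous fun t => (⟨b t, v t + w t⟩ : E.Total) := by
  have hb : Continuous b := E.continuous_base.comp hv
  refine continuous_iff_continuousAt.2 fun t => ?_
  obtain ⟨U, hU, hx, V, _, _, _, φ, hφ⟩ := E.exists_trivialization (b t)
  refine ((hU.preimage hb).isOpenEmbedding_subtypeVal.continuousAt_iff (x := ⟨t, hx⟩)).1
    (Continuous.continuousAt ?_)
  let bU (t : b ⁻¹' U) : U := ⟨b t, t.2⟩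
  have hbU : Continuous bU := (hb.comp continuous_subtype_val).subtype_mk _
  have hv' := (hφ.continuous_total_iff hbU (v := fun t => v t)).1 (hv.comp continuous_subtype_val)
  have hw' := (hφ.continuous_total_iff hbU (v := fun t => w t)).1 (hw.comp continuous_subtype_val)
  refine (hφ.continuous_total_iff hbU (v := fun t => v t + w t)).2 ?_
  simp only [map_add]
  exact hv'.add hw'

theorem continuous_sum_total {b : T → X} (hb : Continuous b) {κ : Type*} (s : Finset κ)
    {v : κ → ∀ t, E.Fiber (b t)}
    (hv : ∀ k ∈ s, Continuous fun t => (⟨b t, v k t⟩ : E.Total)) :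
    Continuous fun t => (⟨b t, ∑ k ∈ s, v k t⟩ : E.Total) := by
  classical
  induction s using Finset.induction_on with
  | empty => simpa using continuous_zero_total hb
  | insert k s hk ih =>
    simp only [Finset.sum_insert hk]
    exact continuous_add_total (hv k (Finset.mem_insert_self k s))
      (ih fun l hl => hv l (Finset.mem_insert_of_mem hl))

end Continuity

section Glue

namespace FrameOn

variable {U : Set X} {ι : Type*} [Fintype ι] (F : FrameOn E U ι) {s : X → ℝ}

open Classical in
/-- The coordinates with respect to a frame over `U`, multiplied by the function `s` and extended
by zero outside of `U`. -/
def cutCoord (s : X → ℝ) (x : X) : E.Fiber x →ₗ[Aᵐᵒᵖ] (ι → A) :=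
  if h : x ∈ U then s x • (F.fiber ⟨x, h⟩).coord else 0

open Classical in
/-- The adjoint of `FrameOn.cutCoord`. -/
def cutSynth (s : X → ℝ) (x : X) : (ι → A) →ₗ[Aᵐᵒᵖ] E.Fiber x :=
  if h : x ∈ U then (F.fiber ⟨x, h⟩).synth ∘ₗ (s x • LinearMap.id) else 0

theorem cutCoord_of_mem {x : X} (hx : x ∈ U) :
    F.cutCoord s x = s x • (F.fiber ⟨x, hx⟩).coord := dif_pos hx

theorem cutSynth_of_mem {x : X} (hx : x ∈ U) (y : ι → A) :
    F.cutSynth s x y = (F.fiber ⟨x, hx⟩).synth (s x • y) := by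
  rw [cutSynth, dif_pos hx]
  rfl

theorem cutCoord_of_eq_zero {x : X} (hx : s x = 0) : F.cutCoord s x = 0 := by
  simp [cutCoord, hx]

theorem cutSynth_of_eq_zero {x : X} (hx : s x = 0) : F.cutSynth s x = 0 := by
  simp [cutSynth, hx]

theorem inner_cutSynth (hs : tsupport s ⊆ U) (x : X) (v : E.Fiber x) (y : ι → A) :
    inner A v (F.cutSynth s x y) = star (F.cutCoord s x v) ⬝ᵥ y := by
  by_cases hx : x ∈ U
  · simp [F.cutSynth_of_mem hx, F.cutCoord_of_mem hx, HilbertModule.Frame.inner_synth, star_smul]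
  · have hsx : s x = 0 := image_eq_zero_of_notMem_tsupport fun h => hx (hs h)
    simp [F.cutSynth_of_eq_zero hsx, F.cutCoord_of_eq_zero hsx, HilbertModule.inner_zero_right]

theorem cutSynth_cutCoord (hs : tsupport s ⊆ U) (x : X) (v : E.Fiber x) :
    F.cutSynth s x (F.cutCoord s x v) = algebraMap ℝ Aᵐᵒᵖ (s x ^ 2) • v := by
  by_cases hx : x ∈ U
  · rw [F.cutSynth_of_mem hx, F.cutCoord_of_mem hx, LinearMap.smul_apply, smul_smul, ← sq,
      ← algebraMap_smul Aᵐᵒᵖ, map_smul, HilbertModule.Frame.synth_coord]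
  · have hsx : s x = 0 := image_eq_zero_of_notMem_tsupport fun h => hx (hs h)
    simp [hsx, F.cutCoord_of_eq_zero hsx]

theorem continuous_cutCoord (hU : IsOpen U) (hs : tsupport s ⊆ U) (hc : Continuous s) :
    Continuous fun p : E.Total => F.cutCoord s p.base p.vec := by
  have hb := E.continuous_base
  refine continuous_of_continuous_preimage_of_tsupport_subset hb hU hs ?_
    (continuous_const (y := 0)) fun p hp => by rw [F.cutCoord_of_eq_zero hp]; rfl
  have h (p : {p : E.Total // p.base ∈ U}) : F.cutCoord s p.1.base p.1.vec =
      s p.1.base • (F.fiber ⟨p.1.base, p.2⟩).coord p.1.vec := by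
    rw [F.cutCoord_of_mem p.2, LinearMap.smul_apply]
  simp only [h]
  exact (hc.comp (hb.comp continuous_subtype_val)).smul F.continuous_coord

theorem continuous_cutSynth (hU : IsOpen U) (hs : tsupport s ⊆ U) (hc : Continuous s) :
    Continuous fun q : X × (ι → A) => (⟨q.1, F.cutSynth s q.1 q.2⟩ : E.Total) := by
  refine continuous_of_continuous_preimage_of_tsupport_subset continuous_fst hU hs ?_
    (continuous_zero_total continuous_fst) fun q hq => by rw [F.cutSynth_of_eq_zero hq]; rfl
  have h (q : {q : X × (ι → A) // q.1 ∈ U}) : F.cutSynth s q.1.1 q.1.2 =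
      (F.fiber ⟨q.1.1, q.2⟩).synth (s q.1.1 • q.1.2) := F.cutSynth_of_mem q.2 _
  simp only [h]
  have h₁ : Continuous fun q : {q : X × (ι → A) // q.1 ∈ U} => (⟨q.1.1, q.2⟩ : U) := by fun_prop
  have h₂ : Continuous fun q : {q : X × (ι → A) // q.1 ∈ U} => s q.1.1 • q.1.2 := by fun_prop
  exact F.continuous_synth.comp (h₁.prodMk h₂)

end FrameOn

/-- The frame glued from frames over the members of an open cover by functions `s k` with
`∑ k, s k ^ 2 = 1`. -/
def Frame.glue {κ : Type*} [Fintype κ] {ι : κ → Type*} [∀ k, Fintype (ι k)] {U : κ → Set X}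
    (hU : ∀ k, IsOpen (U k)) (F : ∀ k, FrameOn E (U k) (ι k)) (s : κ → X → ℝ)
    (hc : ∀ k, Continuous (s k)) (hs : ∀ k, tsupport (s k) ⊆ U k)
    (hsum : ∀ x, ∑ k, s k x ^ 2 = 1) : Frame E (Σ k, ι k) where
  fiber x :=
    { coord := LinearMap.pi fun i => LinearMap.proj i.2 ∘ₗ (F i.1).cutCoord (s i.1) x
      synth := ∑ k, (F k).cutSynth (s k) x ∘ₗ LinearMap.funLeft Aᵐᵒᵖ A (Sigma.mk k)
      synth_coord v :=
        calc _ = ∑ k, (F k).cutSynth (s k) x ((F k).cutCoord (s k) x v) := LinearMap.sum_apply ..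
          _ = ∑ k, algebraMap ℝ Aᵐᵒᵖ (s k x ^ 2) • v :=
            Finset.sum_congr rfl fun k _ => (F k).cutSynth_cutCoord (hs k) x v
          _ = v := by rw [← Finset.sum_smul, ← map_sum, hsum, map_one, one_smul]
      inner_synth v y := by
        rw [LinearMap.sum_apply, HilbertModule.inner_sum_right, dotProduct, Fintype.sum_sigma]
        exact Finset.sum_congr rfl fun k _ => (F k).inner_cutSynth (hs k) x v _ }
  continuous_coord := continuous_pi fun i =>
    (continuous_apply i.2).comp ((F i.1).continuous_cutCoord (hU i.1) (hs i.1) (hc i.1))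
  continuous_synth := by
    simp only [LinearMap.sum_apply]
    refine continuous_sum_total continuous_fst _ fun k _ => ?_
    have h : Continuous fun q : X × ((Σ k, ι k) → A) => (q.1, fun j : ι k => q.2 ⟨k, j⟩) := by
      fun_prop
    exact ((F k).continuous_cutSynth (hU k) (hs k) (hc k)).comp h

theorem _root_.FGPBundle.exists_frame [StarOrderedRing A] [CompactSpace X] [T2Space X]
    (E : FGPBundle A X) : ∃ (ι : Type) (_ : Fintype ι) (_ : DecidableEq ι),
      Nonempty (Frame E.toHilbertBundle ι) := by
  choose U hU hx n F using E.exists_frameOn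
  obtain ⟨N, c, f, hf, hsum, hpos⟩ := exists_finite_partition_of_unity hU hx
  have hs (k : Fin N) : tsupport (fun x => √(f k x)) ⊆ U (c k) :=
    (tsupport_comp_subset Real.sqrt_zero (f k)).trans (hf k)
  exact ⟨Σ k, Fin (n (c k)), inferInstance, inferInstance,
    ⟨.glue (fun k => hU (c k)) (fun k => (F (c k)).some) (fun k x => √(f k x))
      (fun k => by fun_prop) hs fun x => by simp [Real.sq_sqrt (hpos _ x), hsum]⟩⟩

end Glue

end HilbertBundle

namespace HilbertModule

section FixedColumns

variable {A : Type*} [CStarAlgebra A] {ι : Type*} [Fintype ι] {p : Matrix ι ι A}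

/-- The columns fixed by a square matrix; for a projection `p` this is the Hilbert module
`p A ^ ι`. -/
def fixedColumns (p : Matrix ι ι A) : Submodule Aᵐᵒᵖ (Column A ι) :=
  LinearMap.eqLocus (Matrix.mulVecBilin A Aᵐᵒᵖ p ∘ₗ Column.entries.toLinearMap)
    Column.entries.toLinearMap

namespace fixedColumns

theorem mulVec_entries (v : fixedColumns p) :
    p *ᵥ Column.entries (v : Column A ι) = Column.entries (v : Column A ι) := v.2

theorem isClosed : IsClosed (fixedColumns p : Set (Column A ι)) :=
  isClosed_eq (continuous_const.matrix_mulVec Column.entries.continuous) Column.entries.continuous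

end fixedColumns

variable [PartialOrder A] [StarOrderedRing A]

instance : HilbertModule A (Column A ι) where
  inner v w := star (Column.entries v) ⬝ᵥ Column.entries w
  inner_op_smul_right v w a := by
    rw [map_smul, dotProduct_smul]
    rfl
  inner_add_left v₁ v₂ v₃ := by rw [map_add, star_add, add_dotProduct]
  star_inner v w := by rw [Matrix.star_dotProduct, star_star]
  inner_self_nonneg v := Finset.sum_nonneg fun i _ => star_mul_self_nonneg (Column.entries v i)
  inner_self_eq_zero v := by
    rw [← op_eq_zero_iff, ← Column.inner_eq]
    exact CStarModule.inner_self
  norm_eq_sqrt v := by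
    rw [CStarModule.norm_eq_sqrt_norm_inner_self (A := Aᵐᵒᵖ), Column.inner_eq, norm_op]
  complete := inferInstance

/-- A closed submodule of a Hilbert module, as a Hilbert module. -/
abbrev ofIsClosed {V : Type*} [NormedAddCommGroup V] [Module Aᵐᵒᵖ V] [HilbertModule A V]
    (N : Submodule Aᵐᵒᵖ V) (hN : IsClosed (N : Set V)) : HilbertModule A N where
  inner v w := inner A (v : V) (w : V)
  inner_op_smul_right v w a := inner_op_smul_right (v : V) w a
  inner_add_left v₁ v₂ v₃ := inner_add_left (v₁ : V) v₂ v₃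
  star_inner v w := star_inner (v : V) w
  inner_self_nonneg v := inner_self_nonneg (v : V)
  inner_self_eq_zero v := (inner_self_eq_zero (v : V)).trans Submodule.coe_eq_zero
  norm_eq_sqrt v := norm_eq_sqrt (v : V)
  complete :=
    haveI := complete (A := A) (V := V)
    hN.completeSpace_coe

namespace fixedColumns

-- Found before the instances for subgroups and submodules, which unify only after unfolding.
instance : NormedAddCommGroup (fixedColumns p) := (fixedColumns p).normedAddCommGroup

instance : HilbertModule A (fixedColumns p) := ofIsClosed _ isClosed

/-- The frame of `p A ^ ι` given by its inclusion into `A ^ ι` and the projection `p`. -/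
def frame (hp : IsStarProjection p) : Frame A (fixedColumns p) ι where
  coord := Column.entries.toLinearMap ∘ₗ (fixedColumns p).subtype
  synth := LinearMap.codRestrict (fixedColumns p)
    (Column.entries.symm.toLinearMap ∘ₗ Matrix.mulVecBilin A Aᵐᵒᵖ p) fun y => by
      change p *ᵥ (Column.entries (Column.entries.symm (p *ᵥ y))) =
        Column.entries (Column.entries.symm (p *ᵥ y))
      rw [ContinuousLinearEquiv.apply_symm_apply, Matrix.mulVec_mulVec, hp.isIdempotentElem.eq]
  synth_coord v := Subtype.ext (Column.entries.symm_apply_eq.2 (mulVec_entries v))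
  inner_synth v y := by
    change star (Column.entries (v : Column A ι)) ⬝ᵥ
      Column.entries (Column.entries.symm (p *ᵥ y)) = star (Column.entries (v : Column A ι)) ⬝ᵥ y
    rw [ContinuousLinearEquiv.apply_symm_apply]
    nth_rw 2 [← mulVec_entries v]
    rw [Matrix.star_mulVec, ← Matrix.star_eq_conjTranspose, hp.isSelfAdjoint.star_eq,
      ← Matrix.dotProduct_mulVec]

theorem frame_proj [DecidableEq ι] (hp : IsStarProjection p) : (frame hp).proj = p :=
  Matrix.mulVec_injective <| funext fun y =>
    ((frame hp).proj_mulVec y).trans (Column.entries.apply_symm_apply (p *ᵥ y))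

theorem isInducing_coord (hp : IsStarProjection p) : Topology.IsInducing (frame hp).coord :=
  Column.entries.toHomeomorph.isInducing.comp .subtypeVal

end fixedColumns

end FixedColumns

section PartialIsometry

variable {A : Type*} [CStarAlgebra A] [PartialOrder A] {V W : Type*}
  [NormedAddCommGroup V] [Module Aᵐᵒᵖ V] [HilbertModule A V]
  [NormedAddCommGroup W] [Module Aᵐᵒᵖ W] [HilbertModule A W] {ι : Type*} [Fintype ι]

namespace Frame

/-- The map between two Hilbert modules given by a matrix in frame coordinates. -/
def matrixMap (F : Frame A V ι) (G : Frame A W ι) (u : Matrix ι ι A) : V →ₗ[Aᵐᵒᵖ] W :=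
  G.synth ∘ₗ Matrix.mulVecBilin A Aᵐᵒᵖ u ∘ₗ F.coord

theorem matrixMap_apply (F : Frame A V ι) (G : Frame A W ι) (u : Matrix ι ι A) (v : V) :
    F.matrixMap G u v = G.synth (u *ᵥ F.coord v) := rfl

variable [DecidableEq ι] (F : Frame A V ι) (G : Frame A W ι) {u : Matrix ι ι A}

theorem matrixMap_matrixMap_star (hu : star u * u = F.proj) (hu' : u * star u = G.proj) (v : V) :
    G.matrixMap F (star u) (F.matrixMap G u v) = v := by
  rw [matrixMap_apply, matrixMap_apply, ← proj_mulVec, ← hu', Matrix.mulVec_mulVec,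
    Matrix.mulVec_mulVec, mul_assoc, mul_assoc u, hu, ← mul_assoc, hu,
    F.isStarProjection_proj.isIdempotentElem.eq, proj_mulVec_coord, synth_coord]

theorem inner_matrixMap (hu : star u * u = F.proj) (hu' : u * star u = G.proj) (v w : V) :
    inner A (F.matrixMap G u v) (F.matrixMap G u w) = inner A v w := by
  rw [F.matrixMap_apply G u w, G.inner_synth, matrixMap_apply, ← proj_mulVec, ← hu',
    Matrix.mulVec_mulVec, mul_assoc, hu, ← Matrix.mulVec_mulVec, proj_mulVec_coord,
    Matrix.star_mulVec, ← Matrix.dotProduct_mulVec, Matrix.mulVec_mulVec,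
    ← Matrix.star_eq_conjTranspose, hu, proj_mulVec_coord, F.inner_eq]

/-- A partial isometry between the projections of two frames defines an isomorphism. -/
def isoOfPartialIsometry (hu : star u * u = F.proj) (hu' : u * star u = G.proj) :
    HilbertModuleIso A V W where
  toLinearEquiv := .ofLinearMap (F.matrixMap G u) (G.matrixMap F (star u))
    (LinearMap.ext fun w => by
      have := G.matrixMap_matrixMap_star F (u := star u) (by rwa [star_star]) (by rwa [star_star]) w
      rwa [star_star] at this)
    (LinearMap.ext (F.matrixMap_matrixMap_star G hu hu'))
  inner_map := F.inner_matrixMap G hu hu'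

end Frame

end PartialIsometry

end HilbertModule

/-! ### Sections of bundles with frames -/

/-- Evaluation at a point, for functions with values in a ring that need not be commutative. -/
def evalHom {X A : Type*} [TopologicalSpace X] [Ring A] [TopologicalSpace A] [IsTopologicalRing A]
    (x : X) : C(X, A) →+* A :=
  (Pi.evalRingHom (fun _ => A) x).comp ContinuousMap.coeFnRingHom

theorem matrix_ext_evalHom {X A ι : Type*} [TopologicalSpace X] [Ring A] [TopologicalSpace A]
    [IsTopologicalRing A] [Fintype ι] [DecidableEq ι] {m n : Matrix ι ι C(X, A)}
    (h : ∀ x : X, (evalHom x).mapMatrix m = (evalHom x).mapMatrix n) : m = n :=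
  Matrix.ext fun i j => ContinuousMap.ext fun x => congrFun (congrFun (h x) i) j

namespace HilbertBundle

variable {A : Type v} [CStarAlgebra A] [PartialOrder A] {X : Type u} [TopologicalSpace X]
  {E E' : HilbertBundle A X} {ι κ : Type*} [Fintype ι] [Fintype κ]

namespace Frame

section Sections

variable (F : Frame E ι)

/-- The coordinates of the sections of a bundle with respect to a frame. -/
def sectCoord : E.sections →ₗ[C(X, A)ᵐᵒᵖ] (ι → C(X, A)) where
  toFun s i := ⟨fun x => (F.fiber x).coord (s.1 x) i,
    (continuous_apply i).comp (F.continuous_coord.comp s.2)⟩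
  map_add' s t := funext fun i => ContinuousMap.ext fun x =>
    congrFun (map_add (F.fiber x).coord (s.1 x) (t.1 x)) i
  map_smul' f s := funext fun i => ContinuousMap.ext fun x =>
    congrFun (map_smul (F.fiber x).coord (op (f.unop x)) (s.1 x)) i

/-- The section with given coefficients with respect to a frame. -/
def sectSynth : (ι → C(X, A)) →ₗ[C(X, A)ᵐᵒᵖ] E.sections where
  toFun y := ⟨fun x => (F.fiber x).synth fun i => y i x,
    F.continuous_synth.comp (continuous_id.prodMk (continuous_pi fun i => (y i).continuous))⟩
  map_add' y z := Subtype.ext <| funext fun x =>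
    map_add (F.fiber x).synth (fun i => y i x) fun i => z i x
  map_smul' f y := Subtype.ext <| funext fun x =>
    map_smul (F.fiber x).synth (op (f.unop x)) fun i => y i x

theorem sectSynth_comp_sectCoord : F.sectSynth ∘ₗ F.sectCoord = .id :=
  LinearMap.ext fun s => Subtype.ext <| funext fun x => (F.fiber x).synth_coord (s.1 x)

theorem finite_sections [CompactSpace X] (F : Frame E ι) : Module.Finite C(X, A)ᵐᵒᵖ E.sections :=
  Module.Finite.of_surjective F.sectSynth
    (LinearMap.surjective_of_comp_eq_id F.sectCoord F.sectSynth F.sectSynth_comp_sectCoord)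

theorem projective_sections [CompactSpace X] (F : Frame E ι) :
    Module.Projective C(X, A)ᵐᵒᵖ E.sections :=
  Module.Projective.of_split F.sectCoord F.sectSynth F.sectSynth_comp_sectCoord

theorem mapMatrix_evalHom_colMatrix_sectCoord_comp_sectSynth [DecidableEq ι] (x : X) :
    (evalHom x).mapMatrix (colMatrix (F.sectCoord ∘ₗ F.sectSynth)) =
      (F.fiber x).proj := by
  ext i j
  have h : (fun k => (Pi.single j 1 : ι → C(X, A)) k x) = Pi.single j 1 :=
    funext (Pi.apply_single (fun _ => evalHom x) (fun _ => map_zero _) j 1)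
  exact congrArg (fun y => (F.fiber x).coord ((F.fiber x).synth y) i) h

theorem continuous_proj [DecidableEq ι] : Continuous fun x => (F.fiber x).proj :=
  continuous_matrix fun i j => (continuous_apply i).comp <| F.continuous_coord.comp <|
    F.continuous_synth.comp (continuous_id.prodMk (continuous_const (y := Pi.single j 1)))

end Sections

/-- The frame with additional zero coordinates, indexed by a larger type. -/
def extend (F : Frame E ι) (e : ι ↪ κ) : Frame E κ where
  fiber x := (F.fiber x).extend e
  continuous_coord := continuous_pi fun k => by
    change Continuous fun p : E.Total => Function.extend e ((F.fiber p.base).coord p.vec) 0 k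
    by_cases hk : ∃ i, e i = k
    · obtain ⟨i, rfl⟩ := hk
      simp only [e.injective.extend_apply]
      exact (continuous_apply i).comp F.continuous_coord
    · simpa only [Function.extend_apply' _ _ _ hk] using continuous_const
  continuous_synth := F.continuous_synth.comp
    (continuous_fst.prodMk (continuous_pi fun i => (continuous_apply (e i)).comp continuous_snd))

end Frame

theorem isIso_of_partialIsometry [DecidableEq ι] (F : Frame E ι) (F' : Frame E' ι)
    {u : X → Matrix ι ι A} (hu : Continuous u)
    (h : ∀ x, star (u x) * u x = (F.fiber x).proj)
    (h' : ∀ x, u x * star (u x) = (F'.fiber x).proj) : IsIso E E' :=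
  ⟨fun x => (F.fiber x).isoOfPartialIsometry (F'.fiber x) (h x) (h' x),
    F'.continuous_synth.comp (E.continuous_base.prodMk
      ((hu.comp E.continuous_base).matrix_mulVec F.continuous_coord)),
    F.continuous_synth.comp (E'.continuous_base.prodMk
      ((hu.comp E'.continuous_base).matrix_conjTranspose.matrix_mulVec F'.continuous_coord))⟩

end HilbertBundle

section MatrixFamilies

variable {A : Type*} [CStarAlgebra A] [PartialOrder A] [StarOrderedRing A] {ι : Type*}
  [Fintype ι] {Y : Type*} [TopologicalSpace Y]

theorem exists_continuous_matrix_isStarProjection_of_isIdempotentElem {E : Y → Matrix ι ι A}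
    (hE : Continuous E) (he : ∀ y, IsIdempotentElem (E y)) :
    ∃ P : Y → Matrix ι ι A, Continuous P ∧
      ∀ y, IsStarProjection (P y) ∧ E y * P y = P y ∧ P y * E y = E y := by
  classical
  obtain ⟨P, hP, h⟩ :=
    exists_continuous_isStarProjection_of_isIdempotentElem (M := CStarMatrix ι ι A) hE he
  exact ⟨P, hP, fun y => ⟨⟨(h y).1.isIdempotentElem, (h y).1.isSelfAdjoint⟩, (h y).2⟩⟩

theorem exists_continuous_matrix_partialIsometry_of_isRelativeUnit {T P Q : Y → Matrix ι ι A}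
    (hT : Continuous T) (hP : Continuous P) (hp : ∀ y, IsStarProjection (P y))
    (hq : ∀ y, IsSelfAdjoint (Q y)) (h : ∀ y, IsRelativeUnit (P y) (Q y) (T y)) :
    ∃ U : Y → Matrix ι ι A, Continuous U ∧
      ∀ y, star (U y) * U y = P y ∧ U y * star (U y) = Q y := by
  classical
  exact exists_continuous_partialIsometry_of_isRelativeUnit (M := CStarMatrix ι ι A) hT hP
    (fun y => ⟨(hp y).isIdempotentElem, (hp y).isSelfAdjoint⟩) hq
    (fun y => ⟨(h y).mul_eq_self, (h y).eq_self_mul, (h y).exists_inverse⟩)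

end MatrixFamilies

namespace HilbertBundle

variable {A : Type v} [CStarAlgebra A] [PartialOrder A] [StarOrderedRing A] {X : Type u}
  [TopologicalSpace X] {E E' : HilbertBundle A X} {ι κ : Type*} [Fintype ι] [Fintype κ]

theorem isIso_of_sectionsEquiv (F : Frame E ι) (F' : Frame E' κ)
    (e : E.sections ≃ₗ[C(X, A)ᵐᵒᵖ] E'.sections) : IsIso E E' := by
  classical
  let G : Frame E (ι ⊕ κ) := F.extend .inl
  let G' : Frame E' (ι ⊕ κ) := F'.extend .inr
  let T := colMatrix (G'.sectCoord ∘ₗ e ∘ₗ G.sectSynth)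
  let t (x : X) : Matrix (ι ⊕ κ) (ι ⊕ κ) A := (evalHom x).mapMatrix T
  have ht_cont : Continuous t := continuous_matrix fun i j => (T i j).continuous
  have ht (x : X) : IsRelativeUnit (G.fiber x).proj (G'.fiber x).proj (t x) := by
    rw [← Frame.mapMatrix_evalHom_colMatrix_sectCoord_comp_sectSynth,
      ← Frame.mapMatrix_evalHom_colMatrix_sectCoord_comp_sectSynth]
    exact (isRelativeUnit_colMatrix G.sectSynth_comp_sectCoord G'.sectSynth_comp_sectCoord e).map _
  obtain ⟨u, hu, huu⟩ := exists_continuous_matrix_partialIsometry_of_isRelativeUnit ht_cont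
    G.continuous_proj (fun x => (G.fiber x).isStarProjection_proj)
    (fun x => (G'.fiber x).isStarProjection_proj.isSelfAdjoint) ht
  exact isIso_of_partialIsometry G G' hu (fun x => (huu x).1) fun x => (huu x).2

end HilbertBundle

/-! ### Bundles of ranges of projections -/

section Retracts

variable {R L M N : Type*} [Semiring R] [AddCommMonoid L] [Module R L] [AddCommMonoid M]
  [Module R M] [AddCommMonoid N] [Module R N]

/-- Two retracts of a module are isomorphic if the corresponding idempotent endomorphisms have the
same range. -/
def equivOfRetracts {i : M →ₗ[R] L} {r : L →ₗ[R] M} (hr : r ∘ₗ i = .id) {j : N →ₗ[R] L}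
    {k : L →ₗ[R] N} (hk : k ∘ₗ j = .id) (h : (i ∘ₗ r) ∘ₗ (j ∘ₗ k) = j ∘ₗ k)
    (h' : (j ∘ₗ k) ∘ₗ (i ∘ₗ r) = i ∘ₗ r) : M ≃ₗ[R] N :=
  .ofLinearMap (k ∘ₗ i) (r ∘ₗ j)
    (calc (k ∘ₗ i) ∘ₗ (r ∘ₗ j) = k ∘ₗ ((i ∘ₗ r) ∘ₗ (j ∘ₗ (k ∘ₗ j))) := by rw [hk]; rfl
      _ = (k ∘ₗ ((i ∘ₗ r) ∘ₗ (j ∘ₗ k))) ∘ₗ j := rfl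
      _ = (k ∘ₗ j) ∘ₗ (k ∘ₗ j) := by rw [h]; rfl
      _ = .id := by rw [hk]; rfl)
    (calc (r ∘ₗ j) ∘ₗ (k ∘ₗ i) = r ∘ₗ ((j ∘ₗ k) ∘ₗ (i ∘ₗ (r ∘ₗ i))) := by rw [hr]; rfl
      _ = (r ∘ₗ ((j ∘ₗ k) ∘ₗ (i ∘ₗ r))) ∘ₗ i := rfl
      _ = (r ∘ₗ i) ∘ₗ (r ∘ₗ i) := by rw [h']; rfl
      _ = .id := by rw [hr]; rfl)

end Retracts

namespace HilbertModule.fixedColumns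

variable {A : Type*} [CStarAlgebra A] [PartialOrder A] [StarOrderedRing A] {ι : Type*} [Fintype ι]
  {p q u : Matrix ι ι A}

/-- The isomorphism `p A ^ ι ≃ q A ^ ι` given by a partial isometry from `p` to `q`. -/
def iso (hp : IsStarProjection p) (hq : IsStarProjection q) (hu : star u * u = p)
    (hu' : u * star u = q) : HilbertModuleIso A (fixedColumns p) (fixedColumns q) :=
  haveI := Classical.decEq ι
  (frame hp).isoOfPartialIsometry (frame hq) (hu.trans (frame_proj hp).symm)
    (hu'.trans (frame_proj hq).symm)

end HilbertModule.fixedColumns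

namespace HilbertBundle

open HilbertModule

variable {A : Type v} [CStarAlgebra A] {X : Type u} [TopologicalSpace X] {ι : Type u} [Fintype ι]
  {p : X → Matrix ι ι A}

/-- The total space of the family of ranges is topologized as a subspace of `X × A ^ ι`. -/
instance fixedColumnsTopology (p : X → Matrix ι ι A) :
    TopologicalSpace (FamilyTotal fun x => fixedColumns (p x)) :=
  .induced (fun v => (v.base, Column.entries (v.vec : Column A ι))) inferInstance

theorem isInducing_base_entries :
    Topology.IsInducing fun v : FamilyTotal fun x => fixedColumns (p x) =>
      (v.base, Column.entries (v.vec : Column A ι)) := ⟨rfl⟩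

theorem continuous_fixedColumns_base :
    Continuous fun v : FamilyTotal fun x => fixedColumns (p x) => v.base :=
  continuous_fst.comp isInducing_base_entries.continuous

theorem continuous_fixedColumns_entries :
    Continuous fun v : FamilyTotal fun x => fixedColumns (p x) =>
      Column.entries (v.vec : Column A ι) :=
  continuous_snd.comp isInducing_base_entries.continuous

variable [PartialOrder A] [StarOrderedRing A]

theorem continuous_fixedColumns_synth (hc : Continuous p) (hp : ∀ x, IsStarProjection (p x)) :
    Continuous fun q : X × (ι → A) =>
      (⟨q.1, (fixedColumns.frame (hp q.1)).synth q.2⟩ : FamilyTotal fun x => fixedColumns (p x)) :=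
  isInducing_base_entries.continuous_iff.2 <|
    continuous_fst.prodMk ((hc.comp continuous_fst).matrix_mulVec continuous_snd)

theorem isLocalTrivialization_iso (hc : Continuous p) (hp : ∀ x, IsStarProjection (p x))
    {q : Matrix ι ι A} (hq : IsStarProjection q) {U : Set X} {u : U → Matrix ι ι A}
    (hu : Continuous u) (h : ∀ x : U, star (u x) * u x = p x)
    (h' : ∀ x : U, u x * star (u x) = q) :
    IsLocalTrivialization (A := A) (E := fun x => fixedColumns (p x)) fun x : U =>
      fixedColumns.iso (hp x) hq (h x) (h' x) where
  continuous_toFun := by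
    have hb : Continuous fun v : {v : FamilyTotal fun x => fixedColumns (p x) // v.base ∈ U} =>
        (⟨v.1.base, v.2⟩ : U) :=
      (continuous_fixedColumns_base.comp continuous_subtype_val).subtype_mk _
    refine hb.prodMk ((fixedColumns.isInducing_coord hq).continuous_iff.2 ?_)
    exact continuous_const.matrix_mulVec <| (hu.comp hb).matrix_mulVec <|
      continuous_fixedColumns_entries.comp continuous_subtype_val
  continuous_invFun := by
    refine ((continuous_fixedColumns_synth hc hp).comp
      ((continuous_subtype_val.comp continuous_fst).prodMk ?_)).subtype_mk _
    exact (hu.comp continuous_fst).matrix_conjTranspose.matrix_mulVec <|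
      (fixedColumns.isInducing_coord hq).continuous.comp continuous_snd

theorem isOpen_isUnit_matrix [DecidableEq ι] : IsOpen {m : Matrix ι ι A | IsUnit m} :=
  Units.isOpen (R := CStarMatrix ι ι A)

theorem exists_isOpen_partialIsometry (hc : Continuous p) (hp : ∀ x, IsStarProjection (p x))
    (x₀ : X) : ∃ U : Set X, IsOpen U ∧ x₀ ∈ U ∧ ∃ u : U → Matrix ι ι A, Continuous u ∧
      ∀ x : U, star (u x) * u x = p x ∧ u x * star (u x) = p x₀ := by
  classical
  let z (x : X) : Matrix ι ι A := p x₀ * p x + (1 - p x₀) * (1 - p x)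
  have hz : Continuous z := (continuous_const.matrix_mul hc).add
    (continuous_const.matrix_mul (continuous_const.sub hc))
  have hz₀ : z x₀ = 1 := by
    simp only [z, (hp x₀).isIdempotentElem.eq, (hp x₀).isIdempotentElem.one_sub.eq,
      add_sub_cancel]
  refine ⟨_, isOpen_isUnit_matrix.preimage hz, by simp [hz₀], ?_⟩
  exact exists_continuous_matrix_partialIsometry_of_isRelativeUnit
    (continuous_const.matrix_mul (hc.comp continuous_subtype_val)) (hc.comp continuous_subtype_val)
    (fun x => hp x) (fun _ => (hp x₀).isSelfAdjoint) fun x =>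
      isRelativeUnit_mul_of_isUnit (hp x).isIdempotentElem (hp x₀).isIdempotentElem x.2

variable (p) in
/-- The bundle of ranges of a projection-valued function. -/
def ofProj (hc : Continuous p) (hp : ∀ x, IsStarProjection (p x)) : HilbertBundle A X where
  Fiber x := fixedColumns (p x)
  continuous_base := continuous_fixedColumns_base
  exists_trivialization x₀ :=
    let ⟨U, hU, hx, _, hu, h⟩ := exists_isOpen_partialIsometry hc hp x₀
    ⟨U, hU, hx, fixedColumns (p x₀), inferInstance, inferInstance, inferInstance, _,
      isLocalTrivialization_iso hc hp (hp x₀) hu (fun x => (h x).1) fun x => (h x).2⟩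

/-- The frame of the bundle of ranges given by its inclusion into `X × A ^ ι`. -/
def ofProjFrame (hc : Continuous p) (hp : ∀ x, IsStarProjection (p x)) :
    Frame (ofProj p hc hp) ι where
  fiber x := fixedColumns.frame (hp x)
  continuous_coord := continuous_fixedColumns_entries
  continuous_synth := continuous_fixedColumns_synth hc hp

end HilbertBundle

section SectionsEquiv

variable {A : Type v} [CStarAlgebra A] [PartialOrder A] [StarOrderedRing A] {X : Type u}
  [TopologicalSpace X]

theorem FGPBundle.exists_frame_proj_eq {ι : Type u} [Fintype ι] [DecidableEq ι]
    {p : X → Matrix ι ι A} (hc : Continuous p) (hp : ∀ x, IsStarProjection (p x)) :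
    ∃ (E : FGPBundle A X) (F : HilbertBundle.Frame E.toHilbertBundle ι),
      ∀ x, (F.fiber x).proj = p x :=
  ⟨⟨.ofProj p hc hp, fun x => (HilbertModule.fixedColumns.frame (hp x)).isFGP⟩,
    HilbertBundle.ofProjFrame hc hp, fun x => HilbertModule.fixedColumns.frame_proj (hp x)⟩

theorem FGPBundle.exists_sectionsEquiv_of_retract {ι : Type u} [Finite ι] {P : Type*}
    [AddCommGroup P] [Module C(X, A)ᵐᵒᵖ P] {i : P →ₗ[C(X, A)ᵐᵒᵖ] (ι → C(X, A))}
    {r : (ι → C(X, A)) →ₗ[C(X, A)ᵐᵒᵖ] P} (hr : r ∘ₗ i = .id) :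
    ∃ E : FGPBundle A X, Nonempty (P ≃ₗ[C(X, A)ᵐᵒᵖ] E.toHilbertBundle.sections) := by
  classical
  have := Fintype.ofFinite ι
  let m := colMatrix (i ∘ₗ r)
  have hm : IsIdempotentElem m := by
    rw [IsIdempotentElem, ← colMatrix_comp, LinearMap.comp_assoc, ← LinearMap.comp_assoc r, hr,
      LinearMap.id_comp]
  obtain ⟨p, hpc, hp⟩ := exists_continuous_matrix_isStarProjection_of_isIdempotentElem
    (E := fun x => (evalHom x).mapMatrix m) (continuous_matrix fun k l => (m k l).continuous)
    fun x => hm.map _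
  obtain ⟨E, F, hF⟩ := exists_frame_proj_eq hpc fun x => (hp x).1
  refine ⟨E, ⟨equivOfRetracts hr F.sectSynth_comp_sectCoord
    (colMatrix_injective (matrix_ext_evalHom fun x => ?_))
    (colMatrix_injective (matrix_ext_evalHom fun x => ?_))⟩⟩
  · rw [colMatrix_comp, map_mul, F.mapMatrix_evalHom_colMatrix_sectCoord_comp_sectSynth, hF]
    exact (hp x).2.1
  · rw [colMatrix_comp, map_mul, F.mapMatrix_evalHom_colMatrix_sectCoord_comp_sectSynth, hF]
    exact (hp x).2.2

theorem FGPBundle.exists_sectionsEquiv (P : Type*) [AddCommGroup P] [Module C(X, A)ᵐᵒᵖ P]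
    [Module.Finite C(X, A)ᵐᵒᵖ P] [Module.Projective C(X, A)ᵐᵒᵖ P] :
    ∃ E : FGPBundle A X, Nonempty (P ≃ₗ[C(X, A)ᵐᵒᵖ] E.toHilbertBundle.sections) := by
  obtain ⟨n, f, hf⟩ := Module.Finite.exists_fin' C(X, A)ᵐᵒᵖ P
  obtain ⟨g, hg⟩ := Module.projective_lifting_property f LinearMap.id hf
  let σ : (ULift.{u} (Fin n) → C(X, A)) ≃ₗ[C(X, A)ᵐᵒᵖ] (Fin n → C(X, A)ᵐᵒᵖ) :=
    (LinearEquiv.funCongrLeft C(X, A)ᵐᵒᵖ C(X, A) Equiv.ulift.symm).trans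
      (LinearEquiv.piCongrRight fun _ => opLinearEquiv C(X, A)ᵐᵒᵖ)
  refine exists_sectionsEquiv_of_retract (i := σ.symm.toLinearMap ∘ₗ g) (r := f ∘ₗ σ.toLinearMap)
    (LinearMap.ext fun m => ?_)
  simpa only [LinearMap.comp_apply, LinearEquiv.coe_coe, LinearEquiv.apply_symm_apply] using
    DFunLike.congr_fun hg m

end SectionsEquiv

/-! ### The isomorphism of K-groups -/

namespace HilbertBundle

variable {A : Type v} [CStarAlgebra A] [PartialOrder A] {X : Type u} [TopologicalSpace X]

theorem IsIso.nonempty_sectionsEquiv {E F : HilbertBundle A X} :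
    IsIso E F → Nonempty (E.sections ≃ₗ[C(X, A)ᵐᵒᵖ] F.sections) := fun ⟨φ, h, h'⟩ =>
  ⟨{ toFun := fun s => ⟨fun x => (φ x).toLinearEquiv (s.1 x), h.comp s.2⟩
     invFun := fun s => ⟨fun x => (φ x).toLinearEquiv.symm (s.1 x), h'.comp s.2⟩
     map_add' := fun s t => Subtype.ext <| funext fun x =>
      map_add (φ x).toLinearEquiv (s.1 x) (t.1 x)
     map_smul' := fun f s => Subtype.ext <| funext fun x =>
      map_smul (φ x).toLinearEquiv (op (f.unop x)) (s.1 x)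
     left_inv := fun s => Subtype.ext <| funext fun x =>
      (φ x).toLinearEquiv.symm_apply_apply (s.1 x)
     right_inv := fun s => Subtype.ext <| funext fun x =>
      (φ x).toLinearEquiv.apply_symm_apply (s.1 x) }⟩

/-- The sections of a direct sum are pairs of sections. -/
def sectionsSumEquiv [StarOrderedRing A] (E F : HilbertBundle A X) :
    (sum E F).sections ≃ₗ[C(X, A)ᵐᵒᵖ] E.sections × F.sections where
  toFun s := (⟨fun x => HilbertSum.fstHom (A := A) (s.1 x), continuous_sum_fst.comp s.2⟩,
    ⟨fun x => HilbertSum.sndHom (A := A) (s.1 x), continuous_sum_snd.comp s.2⟩)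
  invFun q := ⟨fun x => HilbertSum.mkHom (A := A) (q.1.1 x, q.2.1 x),
    continuous_sum_rng q.1.2 q.2.2⟩
  map_add' _ _ := rfl
  map_smul' _ _ := rfl

end HilbertBundle

section KTheory

variable {A : Type v} [CStarAlgebra A] [PartialOrder A] [StarOrderedRing A] {X : Type u}
  [TopologicalSpace X] [CompactSpace X] [T2Space X]

theorem FGPBundle.finite_sections (E : FGPBundle A X) :
    Module.Finite C(X, A)ᵐᵒᵖ E.toHilbertBundle.sections :=
  let ⟨_, _, _, ⟨F⟩⟩ := E.exists_frame
  F.finite_sections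

theorem FGPBundle.projective_sections (E : FGPBundle A X) :
    Module.Projective C(X, A)ᵐᵒᵖ E.toHilbertBundle.sections :=
  let ⟨_, _, _, ⟨F⟩⟩ := E.exists_frame
  F.projective_sections

/-- The module of sections of a finitely generated projective bundle. -/
def FGPBundle.sectionsModule (E : FGPBundle A X) : FGPModule C(X, A) :=
  ⟨E.toHilbertBundle.sections, E.finite_sections, E.projective_sections⟩

/-- The isomorphism class of the module of sections, as a function of the isomorphism class of the
bundle. -/
def sectionsClass : BundleClass A X → ModuleClass C(X, A) :=
  Quotient.map FGPBundle.sectionsModule fun _ _ h => h.nonempty_sectionsEquiv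

theorem sectionsClass_add (a b : BundleClass A X) :
    sectionsClass (a + b) = sectionsClass a + sectionsClass b := by
  induction a, b using Quotient.inductionOn₂ with
  | h E F =>
    exact Quotient.sound
      (Nonempty.intro (HilbertBundle.sectionsSumEquiv E.toHilbertBundle F.toHilbertBundle))

theorem sectionsClass_injective :
    Function.Injective (sectionsClass : BundleClass A X → ModuleClass C(X, A)) := by
  intro a b h
  induction a, b using Quotient.inductionOn₂ with
  | h E F =>
    obtain ⟨e⟩ := Quotient.exact h
    obtain ⟨_, _, _, ⟨FE⟩⟩ := E.exists_frame
    obtain ⟨_, _, _, ⟨FF⟩⟩ := F.exists_frame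
    exact Quotient.sound (HilbertBundle.isIso_of_sectionsEquiv FE FF e)

theorem sectionsClass_surjective :
    Function.Surjective (sectionsClass : BundleClass A X → ModuleClass C(X, A)) := by
  intro b
  induction b using Quotient.inductionOn with
  | h P =>
    obtain ⟨E, ⟨e⟩⟩ := FGPBundle.exists_sectionsEquiv (A := A) (X := X) P.carrier
    exact ⟨Quotient.mk _ E, Quotient.sound ⟨e.symm⟩⟩

variable (A X) in
/-- The isomorphism `[E] ↦ [C(X, E)]` of K-groups. -/
def bundleKEquiv : BundleK A X ≃+ KZero C(X, A) :=
  grothendieckAddGroupCongr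
    { Equiv.ofBijective sectionsClass ⟨sectionsClass_injective, sectionsClass_surjective⟩ with
      map_add' := sectionsClass_add }

theorem bundleKEquiv_toK (E : FGPBundle A X) :
    bundleKEquiv A X E.toK = E.sectionsModule.toK :=
  grothendieckAddGroupCongr_of _ _

end KTheory

/-! ### The comparison map `C(X) ⊗ A → C(X, A)` -/

section TensorToFun

open scoped ComplexOrder

/-- A real function as a complex function. -/
def ofRealFun {X : Type*} [TopologicalSpace X] : C(X, ℝ) →ₐ[ℝ] C(X, ℂ) :=
  Complex.ofRealAm.compLeftContinuous ℝ Complex.continuous_ofReal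

theorem ofRealFun_apply {X : Type*} [TopologicalSpace X] (f : C(X, ℝ)) (x : X) :
    ofRealFun f x = (f x : ℂ) := rfl

theorem ofRealFun_nonneg {X : Type*} [TopologicalSpace X] {f : C(X, ℝ)} (hf : 0 ≤ f) :
    0 ≤ ofRealFun f :=
  ContinuousMap.le_def.2 fun x => Complex.zero_le_real.2 (hf x)

theorem exists_partition_norm_sub_sum_lt {X : Type*} [TopologicalSpace X] [CompactSpace X]
    [T2Space X] {E : Type*} [NormedAddCommGroup E] [NormedSpace ℝ E] (g : C(X, E)) {ε : ℝ}
    (hε : 0 < ε) :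
    ∃ (n : ℕ) (c : Fin n → X) (f : Fin n → C(X, ℝ)), (∀ i, 0 ≤ f i) ∧
      ∀ x, ‖g x - ∑ i, f i x • g (c i)‖ < ε := by
  obtain ⟨n, c, f, hf, hsum, hpos⟩ := exists_finite_partition_of_unity
    (U := fun x => {y | ‖g y - g x‖ < ε})
    (fun x => isOpen_lt (by fun_prop) continuous_const) (fun x => by simpa using hε)
  refine ⟨n, c, f, fun i => ContinuousMap.le_def.2 (hpos i), fun x => ?_⟩
  have hmem := (convex_ball (g x) ε).finsum_mem (w := fun i => f i x) (z := fun i => g (c i))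
    (fun i => hpos i x) (by rw [finsum_eq_sum_of_fintype, hsum])
    fun i hi => mem_ball_iff_norm'.2 (hf i (subset_tsupport _ hi))
  rwa [finsum_eq_sum_of_fintype, mem_ball_iff_norm'] at hmem

section Definition

variable (X : Type*) [TopologicalSpace X] (A : Type*) [CStarAlgebra A]

/-- Elements of `A` as constant functions. -/
def constFun : A →ₐ[ℂ] C(X, A) where
  toFun := ContinuousMap.const X
  map_one' := rfl
  map_mul' _ _ := rfl
  map_zero' := rfl
  map_add' _ _ := rfl
  commutes' _ := rfl

/-- Scalar functions as functions with values in `A`. -/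
def scalarFun : C(X, ℂ) →ₐ[ℂ] C(X, A) :=
  (Algebra.ofId ℂ A).compLeftContinuous ℂ (continuous_algebraMap ℂ A)

variable {X A}

theorem scalarFun_mul_constFun_apply (f : C(X, ℂ)) (a : A) (x : X) :
    (scalarFun X A f * constFun X A a) x = f x • a :=
  (Algebra.smul_def _ _).symm

theorem commute_scalarFun_constFun (f : C(X, ℂ)) (a : A) :
    Commute (scalarFun X A f) (constFun X A a) :=
  ContinuousMap.ext fun x => Algebra.commutes (f x) a

variable (X A) [CompactSpace X]

/-- The canonical map `C(X) ⊗ A → C(X, A)`, which sends `f ⊗ a` to `x ↦ f x • a`. -/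
def tensorToFun : C(X, ℂ) ⊗[ℂ] A →⋆ₐ[ℂ] C(X, A) where
  toAlgHom := Algebra.TensorProduct.lift (scalarFun X A) (constFun X A) commute_scalarFun_constFun
  map_star' t := by
    change Algebra.TensorProduct.lift (scalarFun X A) (constFun X A) _ (star t) =
      star (Algebra.TensorProduct.lift (scalarFun X A) (constFun X A)
        commute_scalarFun_constFun t)
    induction t using TensorProduct.induction_on with
    | zero => simp only [star_zero, map_zero]
    | tmul f a =>
      ext x
      simp only [TensorProduct.star_tmul, Algebra.TensorProduct.lift_tmul,
        ContinuousMap.star_apply, scalarFun_mul_constFun_apply, star_smul]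
    | add s t hs ht => simp only [star_add, map_add, hs, ht]

variable {X A}

theorem tensorToFun_tmul (f : C(X, ℂ)) (a : A) (x : X) :
    tensorToFun X A (f ⊗ₜ a) x = f x • a := by
  rw [← scalarFun_mul_constFun_apply]
  exact congr($(Algebra.TensorProduct.lift_tmul _ _ commute_scalarFun_constFun f a) x)

variable (X A) in
theorem injective_tensorToFun : Function.Injective (tensorToFun X A) := by
  classical
  rw [injective_iff_map_eq_zero]
  intro t ht
  let b := Module.Basis.ofVectorSpace ℂ A
  obtain ⟨f, rfl⟩ := (TensorProduct.equivFinsuppOfBasisRight (M := C(X, ℂ)) b).symm.surjective t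
  rw [TensorProduct.equivFinsuppOfBasisRight_symm_apply] at ht
  have hf (x : X) : f.mapRange (fun g => g x) (ContinuousMap.zero_apply x) = 0 := by
    refine linearIndependent_iff.1 b.linearIndependent _ ?_
    rw [Finsupp.linearCombination_apply, Finsupp.sum_mapRange_index fun i => zero_smul ℂ (b i)]
    simpa [Finsupp.sum, tensorToFun_tmul] using congr($ht x)
  rw [EmbeddingLike.map_eq_zero_iff]
  ext i x
  exact congr($(hf x) i)

variable (X A) in
theorem denseRange_tensorToFun [T2Space X] : DenseRange (tensorToFun X A) := by
  refine fun g => Metric.mem_closure_range_iff.2 fun ε hε => ?_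
  obtain ⟨n, c, f, -, happrox⟩ := exists_partition_norm_sub_sum_lt g (half_pos hε)
  refine ⟨∑ i, ofRealFun (f i) ⊗ₜ g (c i), ?_⟩
  rw [dist_eq_norm]
  refine lt_of_le_of_lt ((ContinuousMap.norm_le _ (half_pos hε).le).2 fun x => ?_)
    (half_lt_self hε)
  simpa [tensorToFun_tmul, ofRealFun_apply] using (happrox x).le

end Definition

section Norm

variable {A B C : Type*} [CStarAlgebra A] [CStarAlgebra B] [CStarAlgebra C]

theorem norm_map_tmul_le (j : A ⊗[ℂ] B →⋆ₐ[ℂ] C) (a : A) (b : B) :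
    ‖j (a ⊗ₜ b)‖ ≤ ‖a‖ * ‖b‖ := by
  let jleft : A →⋆ₐ[ℂ] C :=
    { j.toAlgHom.comp Algebra.TensorProduct.includeLeft with
      map_star' := fun a => by
        change j (star a ⊗ₜ 1) = star (j (a ⊗ₜ 1))
        rw [← map_star, TensorProduct.star_tmul, star_one] }
  let jright : B →⋆ₐ[ℂ] C :=
    { j.toAlgHom.comp Algebra.TensorProduct.includeRight with
      map_star' := fun b => by
        change j (1 ⊗ₜ star b) = star (j (1 ⊗ₜ b))
        rw [← map_star, TensorProduct.star_tmul, star_one] }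
  have hmul : j (a ⊗ₜ b) = jleft a * jright b := by
    change _ = j (a ⊗ₜ 1) * j (1 ⊗ₜ b)
    rw [← map_mul, Algebra.TensorProduct.tmul_mul_tmul, mul_one, one_mul]
  rw [hmul]
  refine (norm_mul_le _ _).trans ?_
  gcongr <;> exact NonUnitalStarAlgHom.norm_apply_le _ _

theorem map_tmul_nonneg [PartialOrder A] [StarOrderedRing A] [PartialOrder B] [StarOrderedRing B]
    [PartialOrder C] [StarOrderedRing C] (j : A ⊗[ℂ] B →⋆ₐ[ℂ] C) {a : A} (ha : 0 ≤ a) {b : B}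
    (hb : 0 ≤ b) : 0 ≤ j (a ⊗ₜ b) := by
  obtain ⟨x, rfl⟩ := CStarAlgebra.nonneg_iff_eq_star_mul_self.1 ha
  obtain ⟨y, rfl⟩ := CStarAlgebra.nonneg_iff_eq_star_mul_self.1 hb
  rw [← Algebra.TensorProduct.tmul_mul_tmul, ← TensorProduct.star_tmul, map_mul, map_star]
  exact star_mul_self_nonneg _

variable {X : Type*} [TopologicalSpace X] [CompactSpace X] [T2Space X]
  (j : C(X, ℂ) ⊗[ℂ] A →⋆ₐ[ℂ] B)

theorem exists_partition_norm_map_sub_sum_lt (t : C(X, ℂ) ⊗[ℂ] A) {ε : ℝ} (hε : 0 < ε) :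
    ∃ (n : ℕ) (c : Fin n → X) (f : Fin n → C(X, ℝ)), (∀ i, 0 ≤ f i) ∧
      ‖j t - ∑ i, j (ofRealFun (f i) ⊗ₜ tensorToFun X A t (c i))‖ < ε := by
  obtain ⟨m, g, a, rfl⟩ : ∃ (m : ℕ) (g : Fin m → C(X, ℂ)) (a : Fin m → A),
      t = ∑ k, g k ⊗ₜ a k := TensorProduct.exists_sum_tmul_eq t
  let δ := ε / (1 + ∑ k, ‖a k‖)
  have : 0 ≤ ∑ k, ‖a k‖ := Finset.sum_nonneg fun k _ => norm_nonneg _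
  have hδ : 0 < δ := by positivity
  obtain ⟨n, c, f, hf, happrox⟩ := exists_partition_norm_sub_sum_lt (ContinuousMap.pi g) hδ
  refine ⟨n, c, f, hf, ?_⟩
  have hg (k : Fin m) : ‖g k - ∑ i, g k (c i) • ofRealFun (f i)‖ ≤ δ := by
    refine (ContinuousMap.norm_le _ hδ.le).2 fun x => ?_
    simpa [ofRealFun_apply, mul_comm] using (norm_le_pi_norm _ k).trans (happrox x).le
  have hsub : ∑ k, g k ⊗ₜ[ℂ] a k - ∑ i, ofRealFun (f i) ⊗ₜ[ℂ]
      tensorToFun X A (∑ k, g k ⊗ₜ a k) (c i) =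
      ∑ k, (g k - ∑ i, g k (c i) • ofRealFun (f i)) ⊗ₜ[ℂ] a k := by
    simp only [TensorProduct.sub_tmul, TensorProduct.sum_tmul, Finset.sum_sub_distrib, map_sum,
      ContinuousMap.coe_sum, Finset.sum_apply, tensorToFun_tmul, TensorProduct.tmul_sum,
      TensorProduct.smul_tmul]
    rw [Finset.sum_comm]
  rw [← map_sum, ← map_sub, hsub, map_sum]
  calc _ ≤ ∑ k, δ * ‖a k‖ := norm_sum_le_of_le _ fun k _ =>
        (norm_map_tmul_le j _ _).trans (by gcongr; exact hg k)
    _ < ε := by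
        rw [← Finset.mul_sum, div_mul_eq_mul_div, div_lt_iff₀ (by positivity)]
        gcongr
        exact lt_one_add _

theorem map_nonneg_of_tensorToFun_nonneg [PartialOrder A] [StarOrderedRing A] [PartialOrder B]
    [StarOrderedRing B] {t : C(X, ℂ) ⊗[ℂ] A} (ht : ∀ x, 0 ≤ tensorToFun X A t x) : 0 ≤ j t := by
  refine CStarAlgebra.isClosed_nonneg.closure_subset (Metric.mem_closure_iff.2 fun ε hε => ?_)
  obtain ⟨n, c, f, hf, happrox⟩ := exists_partition_norm_map_sub_sum_lt j t hε
  refine ⟨∑ i, j (ofRealFun (f i) ⊗ₜ tensorToFun X A t (c i)), ?_, by rwa [dist_eq_norm]⟩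
  exact Finset.sum_nonneg fun i _ => map_tmul_nonneg j (ofRealFun_nonneg (hf i)) (ht (c i))

end Norm

end TensorToFun

section Positivity

open scoped ComplexOrder

theorem norm_map_le_iff {D B : Type*} [Ring D] [StarRing D] [Algebra ℂ D] [CStarAlgebra B]
    [PartialOrder B] [StarOrderedRing B] (φ : D →⋆ₐ[ℂ] B) (d : D) {r : ℝ} (hr : 0 ≤ r) :
    ‖φ d‖ ≤ r ↔ 0 ≤ φ (((r ^ 2 : ℝ) : ℂ) • 1 - star d * d) := by
  rw [map_sub, map_mul, map_star, map_smul, map_one, Complex.coe_smul,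
    ← Algebra.algebraMap_eq_smul_one, sub_nonneg,
    ← CStarAlgebra.norm_le_iff_le_algebraMap _ (sq_nonneg r) (star_mul_self_nonneg _),
    CStarRing.norm_star_mul_self, ← sq, sq_le_sq₀ (norm_nonneg _) hr]

variable {X : Type*} [TopologicalSpace X] {A B : Type*}
  [CStarAlgebra A] [CStarAlgebra B]

/-- Evaluation at a point as a homomorphism of involutive algebras. -/
def evalStarHom (A : Type*) [CStarAlgebra A] (x : X) : C(X, A) →⋆ₐ[ℂ] A where
  toFun g := g x
  map_one' := rfl
  map_mul' _ _ := rfl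
  map_zero' := rfl
  map_add' _ _ := rfl
  commutes' _ := rfl
  map_star' _ := rfl

/-- The hat function of height `ε` and radius `ε` around a point, measured through `g`. -/
def hatFun (g : C(X, A)) (x₀ : X) (ε : ℝ) : C(X, ℝ) where
  toFun x := max 0 (ε - ‖g x - g x₀‖)

theorem hatFun_apply_self (g : C(X, A)) (x₀ : X) {ε : ℝ} (hε : 0 ≤ ε) :
    hatFun g x₀ ε x₀ = ε := by
  simp [hatFun, hε]

theorem hatFun_eq_zero_or_norm_le (g : C(X, A)) (x₀ : X) (ε : ℝ) (x : X) :
    hatFun g x₀ ε x = 0 ∨ ‖g x - g x₀‖ ≤ ε := by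
  rcases le_total ‖g x - g x₀‖ ε with h | h
  · exact .inr h
  · exact .inl (max_eq_left (sub_nonpos.2 h))

theorem isSelfAdjoint_tensorToFun_apply [CompactSpace X] {j : C(X, ℂ) ⊗[ℂ] A →⋆ₐ[ℂ] B}
    (hj : Function.Injective j) {t : C(X, ℂ) ⊗[ℂ] A} (ht : IsSelfAdjoint (j t)) (x : X) :
    IsSelfAdjoint (tensorToFun X A t x) := by
  have htsa : IsSelfAdjoint t := hj ((map_star j t).trans ht.star_eq)
  exact congr($((map_star (tensorToFun X A) t).symm.trans (congrArg _ htsa.star_eq)) x)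

theorem negPart_mul_mul_negPart {c : A} (hc : IsSelfAdjoint c) :
    c⁻ * c * c⁻ = -(c⁻ * c⁻ * c⁻) := by
  have h : c⁻ * c = -(c⁻ * c⁻) := by
    nth_rw 2 [← CFC.posPart_sub_negPart c hc]
    rw [mul_sub, CFC.negPart_mul_posPart, zero_sub]
  rw [h, neg_mul]

variable [PartialOrder A] [StarOrderedRing A] [PartialOrder B] [StarOrderedRing B]

theorem nonneg_of_negPart_mul_mul_eq_zero {c : A} (hc : IsSelfAdjoint c)
    (h : c⁻ * c⁻ * c⁻ = 0) : 0 ≤ c := by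
  have hstar : star c⁻ = c⁻ := (CFC.negPart_nonneg c).isSelfAdjoint.star_eq
  have hsq : c⁻ * c⁻ = 0 := by
    rw [← CStarRing.star_mul_self_eq_zero_iff, star_mul, hstar, mul_assoc, ← mul_assoc c⁻ c⁻ c⁻,
      h, mul_zero]
  rwa [← CFC.negPart_eq_zero_iff c, ← CStarRing.star_mul_self_eq_zero_iff, hstar]

theorem le_add_algebraMap_of_norm_sub_le {a b : A} (ha : IsSelfAdjoint a) (hb : IsSelfAdjoint b)
    {ε : ℝ} (h : ‖a - b‖ ≤ ε) : a ≤ b + algebraMap ℝ A ε := by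
  rw [← sub_le_iff_le_add']
  exact (ha.sub hb).le_algebraMap_norm_self.trans (algebraMap_mono A h)

variable [CompactSpace X] [T2Space X] {j : C(X, ℂ) ⊗[ℂ] A →⋆ₐ[ℂ] B}

theorem eq_zero_of_map_conjugate_nonneg (hj : Function.Injective j) {s t : C(X, ℂ) ⊗[ℂ] A}
    (y : C(X, ℂ) ⊗[ℂ] A) (ht : 0 ≤ j t) (hs : 0 ≤ j s)
    (h : ∀ x, 0 ≤ tensorToFun X A (-(star y * t * y) - s) x) : s = 0 := by
  have hle : j s ≤ -(star (j y) * j t * j y) := by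
    have := map_nonneg_of_tensorToFun_nonneg j h
    rwa [map_sub, map_neg, map_mul, map_mul, map_star, sub_nonneg] at this
  refine hj ((le_antisymm (hle.trans ?_) hs).trans (map_zero j).symm)
  exact neg_nonpos.2 (star_left_conjugate_nonneg ht _)

theorem tensorToFun_add_algebraMap_nonneg (hj : Function.Injective j) {t : C(X, ℂ) ⊗[ℂ] A}
    (ht : 0 ≤ j t) (x₀ : X) {ε : ℝ} (hε : 0 < ε) :
    0 ≤ tensorToFun X A t x₀ + algebraMap ℝ A ε := by
  set g := tensorToFun X A t with hg
  have hsa := isSelfAdjoint_tensorToFun_apply hj ht.isSelfAdjoint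
  set c := g x₀ + algebraMap ℝ A ε
  have hcsa : IsSelfAdjoint c := (hsa x₀).add (IsSelfAdjoint.algebraMap A (.all ε))
  have hneg : IsSelfAdjoint c⁻ := (CFC.negPart_nonneg c).isSelfAdjoint
  let f := hatFun g x₀ ε
  have hzero : ofRealFun (f * f) ⊗ₜ[ℂ] (c⁻ * c⁻ * c⁻) = 0 := by
    refine eq_zero_of_map_conjugate_nonneg hj (ofRealFun f ⊗ₜ c⁻) ht
      (map_tmul_nonneg j (ofRealFun_nonneg (ContinuousMap.le_def.2 fun _ => mul_self_nonneg _))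
        (hneg.conjugate_nonneg (CFC.negPart_nonneg c))) fun x => ?_
    have heval : tensorToFun X A (-(star (ofRealFun f ⊗ₜ c⁻) * t * ofRealFun f ⊗ₜ c⁻) -
        ofRealFun (f * f) ⊗ₜ[ℂ] (c⁻ * c⁻ * c⁻)) x =
        (f x * f x) • (c⁻ * c * c⁻ - c⁻ * g x * c⁻) := by
      rw [negPart_mul_mul_negPart hcsa]
      simp only [map_sub, map_neg, map_mul, map_star, ContinuousMap.sub_apply,
        ContinuousMap.neg_apply, ContinuousMap.mul_apply, ContinuousMap.star_apply,
        tensorToFun_tmul, ofRealFun_apply, Complex.coe_smul, star_smul, hneg.star_eq, star_trivial,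
        smul_mul_assoc, mul_smul_comm, smul_smul, smul_sub, smul_neg, ← Complex.ofReal_mul, ← hg]
      abel
    rw [heval]
    rcases hatFun_eq_zero_or_norm_le g x₀ ε x with hx | hx
    · simp only [f, hx, mul_zero, zero_smul, le_refl]
    · exact smul_nonneg (mul_self_nonneg _) (sub_nonneg.2 (hneg.conjugate_le_conjugate
        (le_add_algebraMap_of_norm_sub_le (hsa x) (hsa x₀) hx)))
  refine nonneg_of_negPart_mul_mul_eq_zero hcsa ?_
  have := congr(tensorToFun X A $hzero x₀)
  rw [tensorToFun_tmul, ofRealFun_apply, map_zero, ContinuousMap.zero_apply] at this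
  refine (smul_eq_zero.1 this).resolve_left ?_
  simp [f, hatFun_apply_self g x₀ hε.le, hε.ne']

theorem tensorToFun_nonneg_of_map_nonneg (hj : Function.Injective j) {t : C(X, ℂ) ⊗[ℂ] A}
    (ht : 0 ≤ j t) (x : X) : 0 ≤ tensorToFun X A t x := by
  have hlim : Filter.Tendsto (fun ε : ℝ => tensorToFun X A t x + algebraMap ℝ A ε)
      (nhdsWithin 0 (Set.Ioi 0)) (nhds (tensorToFun X A t x)) := by
    have : Continuous fun ε : ℝ => tensorToFun X A t x + algebraMap ℝ A ε :=
      continuous_const.add (continuous_algebraMap ℝ A)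
    simpa using (this.tendsto 0).mono_left nhdsWithin_le_nhds
  exact CStarAlgebra.isClosed_nonneg.mem_of_tendsto hlim
    (Filter.mem_of_superset self_mem_nhdsWithin fun ε hε =>
      tensorToFun_add_algebraMap_nonneg hj ht x hε)

end Positivity

section NormUniqueness

variable {X : Type*} [TopologicalSpace X] [CompactSpace X] [T2Space X] {A B : Type*}
  [CStarAlgebra A] [CStarAlgebra B]

theorem norm_map_le_norm_tensorToFun (j : C(X, ℂ) ⊗[ℂ] A →⋆ₐ[ℂ] B) (t : C(X, ℂ) ⊗[ℂ] A) :
    ‖j t‖ ≤ ‖tensorToFun X A t‖ := by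
  let := CStarAlgebra.spectralOrder A
  have := CStarAlgebra.spectralOrderedRing A
  let := CStarAlgebra.spectralOrder B
  have := CStarAlgebra.spectralOrderedRing B
  refine (norm_map_le_iff j t (norm_nonneg (tensorToFun X A t))).2
    (map_nonneg_of_tensorToFun_nonneg j fun x => ?_)
  exact (norm_map_le_iff ((evalStarHom A x).comp (tensorToFun X A)) t
    (norm_nonneg (tensorToFun X A t))).1
    ((tensorToFun X A t).norm_coe_le_norm x)

theorem norm_map_eq_of_injective {j : C(X, ℂ) ⊗[ℂ] A →⋆ₐ[ℂ] B} (hj : Function.Injective j)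
    (t : C(X, ℂ) ⊗[ℂ] A) : ‖j t‖ = ‖tensorToFun X A t‖ := by
  let := CStarAlgebra.spectralOrder A
  have := CStarAlgebra.spectralOrderedRing A
  let := CStarAlgebra.spectralOrder B
  have := CStarAlgebra.spectralOrderedRing B
  refine le_antisymm (norm_map_le_norm_tensorToFun j t)
    ((ContinuousMap.norm_le _ (norm_nonneg _)).2 fun x => ?_)
  exact (norm_map_le_iff ((evalStarHom A x).comp (tensorToFun X A)) t (norm_nonneg (j t))).2
    (tensorToFun_nonneg_of_map_nonneg hj ((norm_map_le_iff j t (norm_nonneg _)).1 le_rfl) x)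

end NormUniqueness

/-! ### The minimal norm -/

section States

open scoped ComplexOrder

theorem eq_ofReal_of_norm_le_of_le_re {z : ℂ} {r : ℝ} (hz : ‖z‖ ≤ r) (hr : r ≤ z.re) : z = r := by
  have hre : z.re = r := le_antisymm ((Complex.re_le_norm z).trans hz) hr
  have hnonneg := Complex.re_eq_norm.1 ((Complex.re_le_norm z).antisymm (hz.trans hr))
  exact Complex.ext hre (Complex.le_def.1 hnonneg).2.symm

variable {A : Type*} [CStarAlgebra A]

theorem norm_one_le_one : ‖(1 : A)‖ ≤ 1 := by
  cases subsingleton_or_nontrivial A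
  · simp [Subsingleton.elim (1 : A) 0]
  · exact CStarRing.norm_one.le

theorem norm_add_smul_one_sq_le {a : A} (ha : IsSelfAdjoint a) (t : ℝ) :
    ‖a + (t * Complex.I : ℂ) • 1‖ ^ 2 ≤ ‖a‖ ^ 2 + t ^ 2 := by
  have hstar : star (a + (t * Complex.I : ℂ) • 1) * (a + (t * Complex.I : ℂ) • 1) =
      a * a + (t ^ 2 : ℝ) • 1 := by
    have hI : (t * Complex.I) * (t * Complex.I) = -(t ^ 2 : ℝ) := by
      push_cast
      linear_combination (t : ℂ) ^ 2 * Complex.I_mul_I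
    simp only [star_add, star_smul, star_one, ha.star_eq, Complex.star_def, map_mul,
      Complex.conj_ofReal, Complex.conj_I, mul_neg, neg_smul, add_mul, mul_add, neg_mul,
      smul_mul_assoc, mul_smul_comm, one_mul, mul_one]
    rw [smul_add, smul_neg, smul_smul, hI, ← Complex.coe_smul]
    module
  calc _ = ‖a * a + (t ^ 2 : ℝ) • (1 : A)‖ := by rw [sq, ← CStarRing.norm_star_mul_self, hstar]
    _ ≤ ‖a‖ * ‖a‖ + ‖t ^ 2‖ * ‖(1 : A)‖ :=
      (norm_add_le _ _).trans (add_le_add (norm_mul_le _ _) (norm_smul_le _ _))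
    _ ≤ ‖a‖ ^ 2 + t ^ 2 := by
      rw [Real.norm_of_nonneg (sq_nonneg t), ← sq]
      gcongr
      exact mul_le_of_le_one_right (sq_nonneg t) norm_one_le_one

theorem im_eq_zero_of_norm_le_one {f : A →L[ℂ] ℂ} (hf : ‖f‖ ≤ 1) (hone : f 1 = 1) {a : A}
    (ha : IsSelfAdjoint a) : (f a).im = 0 := by
  have hle (t : ℝ) : ((f a).im + t) ^ 2 ≤ ‖a‖ ^ 2 + t ^ 2 := by
    have him : (f (a + (t * Complex.I : ℂ) • 1)).im = (f a).im + t := by simp [hone]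
    calc ((f a).im + t) ^ 2 ≤ ‖f (a + (t * Complex.I : ℂ) • 1)‖ ^ 2 := by
          rw [← him, ← sq_abs]
          gcongr
          exact Complex.abs_im_le_norm _
      _ ≤ ‖a + (t * Complex.I : ℂ) • 1‖ ^ 2 := by
          gcongr
          exact (f.le_of_opNorm_le hf _).trans_eq (one_mul _)
      _ ≤ ‖a‖ ^ 2 + t ^ 2 := norm_add_smul_one_sq_le ha t
  by_contra him
  have hlarge := hle ((‖a‖ ^ 2 + 1) / (2 * (f a).im))
  have hcancel : 2 * (f a).im * ((‖a‖ ^ 2 + 1) / (2 * (f a).im)) = ‖a‖ ^ 2 + 1 := by field_simp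
  nlinarith [sq_nonneg (f a).im]

variable [PartialOrder A] [StarOrderedRing A]

theorem nonneg_of_norm_le_one {f : A →L[ℂ] ℂ} (hf : ‖f‖ ≤ 1) (hone : f 1 = 1) {a : A}
    (ha : 0 ≤ a) : 0 ≤ f a := by
  have hnorm : ‖algebraMap ℝ A ‖a‖ - a‖ ≤ ‖a‖ :=
    (CStarAlgebra.norm_le_iff_le_algebraMap _ (norm_nonneg a)
      (sub_nonneg.2 ha.isSelfAdjoint.le_algebraMap_norm_self)).2 (sub_le_self _ ha)
  have heq : f (algebraMap ℝ A ‖a‖ - a) = ‖a‖ - f a := by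
    rw [map_sub, Algebra.algebraMap_eq_smul_one, ← Complex.coe_smul, map_smul, hone, smul_eq_mul,
      mul_one]
  have hre : |‖a‖ - (f a).re| ≤ ‖a‖ := by
    have := (f.le_of_opNorm_le hf _).trans ((one_mul _).trans_le hnorm)
    rw [heq] at this
    simpa using (Complex.abs_re_le_norm _).trans this
  refine Complex.nonneg_iff.2 ⟨?_, (im_eq_zero_of_norm_le_one hf hone ha.isSelfAdjoint).symm⟩
  linarith [(abs_le.1 hre).2]

theorem norm_add_one_of_nonneg [Nontrivial A] {b : A} (hb : 0 ≤ b) : ‖b + 1‖ = ‖b‖ + 1 := by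
  refine le_antisymm ((norm_add_le _ _).trans_eq (by rw [CStarRing.norm_one])) ?_
  have hmem : ‖b‖ + 1 ∈ spectrum ℝ (algebraMap ℝ A 1 + b) :=
    spectrum.add_mem_add_iff.2 (CStarAlgebra.norm_mem_spectrum_of_nonneg hb)
  have hle := spectrum.norm_le_norm_of_mem hmem
  rwa [map_one, add_comm 1 b, Real.norm_of_nonneg (by positivity)] at hle

theorem exists_state_apply_eq_norm [Nontrivial A] {b : A} (hb : 0 ≤ b) :
    ∃ f : A →ₚ[ℂ] ℂ, f 1 = 1 ∧ f b = ‖b‖ := by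
  -- Norming `b + 1` instead of `b` forces the functional to be unital.
  obtain ⟨f, hf, hfb⟩ := exists_dual_vector'' ℂ (b + 1)
  have hle (a : A) : ‖f a‖ ≤ ‖a‖ := (f.le_of_opNorm_le hf a).trans_eq (one_mul _)
  have hle_one : ‖f 1‖ ≤ 1 := (hle 1).trans_eq CStarRing.norm_one
  have hre : (f b).re + (f 1).re = ‖b‖ + 1 := by
    rw [← Complex.add_re, ← map_add, hfb, norm_add_one_of_nonneg hb]
    exact Complex.ofReal_re _
  have hone : f 1 = 1 := mod_cast eq_ofReal_of_norm_le_of_le_re hle_one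
    (by linarith [(Complex.re_le_norm (f b)).trans (hle b)])
  have hfb : f b = ‖b‖ := eq_ofReal_of_norm_le_of_le_re (hle b)
    (by linarith [(Complex.re_le_norm (f 1)).trans hle_one])
  exact ⟨.mk₀ f.toLinearMap fun a ha => nonneg_of_norm_le_one hf hone ha, hone, hfb⟩

theorem gnsStarAlgHom_apply_toPreGNS_one (f : A →ₚ[ℂ] ℂ) (a : A) :
    f.gnsStarAlgHom a ((f.toPreGNS 1 : f.PreGNS) : f.GNS) =
      ((f.toPreGNS a : f.PreGNS) : f.GNS) := by
  change f.gnsNonUnitalStarAlgHom a _ = _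
  simp [PositiveLinearMap.gnsNonUnitalStarAlgHom_apply_coe]

theorem norm_toPreGNS_eq_of_apply_eq {f : A →ₚ[ℂ] ℂ} {a : A}
    (ha : f (star a * a) = ‖star a * a‖) : ‖((f.toPreGNS a : f.PreGNS) : f.GNS)‖ = ‖a‖ := by
  have hsq : (‖f.toPreGNS a‖ ^ 2 : ℂ) = f (star a * a) := f.preGNS_norm_sq (f.toPreGNS a)
  rw [ha, CStarRing.norm_star_mul_self, ← sq] at hsq
  rw [UniformSpace.Completion.norm_coe, ← sq_eq_sq₀ (norm_nonneg _) (norm_nonneg _)]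
  exact_mod_cast hsq

end States

open scoped ComplexOrder in
theorem exists_representation_norm_apply_eq {A : Type v} [CStarAlgebra A] (a : A) :
    ∃ (K : Type v) (_ : NormedAddCommGroup K) (_ : InnerProductSpace ℂ K) (_ : CompleteSpace K)
      (ρ : A →⋆ₐ[ℂ] (K →L[ℂ] K)) (ξ : K), ‖ξ‖ ≤ 1 ∧ ‖ρ a ξ‖ = ‖a‖ := by
  let := CStarAlgebra.spectralOrder A
  have := CStarAlgebra.spectralOrderedRing A
  obtain ⟨f, hone, hnorm⟩ : ∃ f : A →ₚ[ℂ] ℂ, f 1 = ‖(1 : A)‖ ∧ f (star a * a) = ‖star a * a‖ := by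
    cases subsingleton_or_nontrivial A
    · exact ⟨0, by simp [Subsingleton.elim (1 : A) 0], by simp [Subsingleton.elim a 0]⟩
    · simpa using exists_state_apply_eq_norm (star_mul_self_nonneg a)
  refine ⟨f.GNS, inferInstance, inferInstance, inferInstance, f.gnsStarAlgHom,
    ((f.toPreGNS 1 : f.PreGNS) : f.GNS), ?_, ?_⟩
  · rw [norm_toPreGNS_eq_of_apply_eq (by simpa using hone)]
    exact norm_one_le_one
  · rw [gnsStarAlgHom_apply_toPreGNS_one, norm_toPreGNS_eq_of_apply_eq hnorm]

section CompletionHom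

open UniformSpace (Completion)
open UniformSpace.Completion (coe_add coe_smul coe_zero)

variable {E : Type*} [NormedAddCommGroup E] [NormedSpace ℂ E]

theorem completion_clm_ext {S T : Completion E →L[ℂ] Completion E}
    (h : ∀ x : E, S x = T x) : S = T :=
  DFunLike.coe_injective (Completion.ext S.continuous T.continuous h)

variable (E) in
/-- The extension of bounded operators to the completion, as a homomorphism of algebras. -/
def completionHom : (E →L[ℂ] E) →ₐ[ℂ] (Completion E →L[ℂ] Completion E) where
  toFun := .completion
  map_one' := completion_clm_ext fun x => by simp
  map_mul' S T := completion_clm_ext fun x => by simp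
  map_zero' := completion_clm_ext fun x => by simp
  map_add' S T := completion_clm_ext fun x => by simp [coe_add]
  commutes' c := completion_clm_ext fun x => by simp [Algebra.algebraMap_eq_smul_one, coe_smul]

theorem completionHom_apply_coe (T : E →L[ℂ] E) (x : E) :
    completionHom E T x = (T x : E) := T.completion_apply_coe x

theorem norm_le_norm_completionHom (T : E →L[ℂ] E) : ‖T‖ ≤ ‖completionHom E T‖ := by
  refine T.opNorm_le_bound (norm_nonneg _) fun x => ?_
  simpa only [completionHom_apply_coe, Completion.norm_coe] using
    (completionHom E T).le_opNorm x

theorem star_completionHom {E : Type*} [NormedAddCommGroup E] [InnerProductSpace ℂ E]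
    {S T : E →L[ℂ] E} (h : ∀ x y, inner ℂ (S x) y = inner ℂ x (T y)) :
    star (completionHom E T) = completionHom E S := by
  refine .symm ((ContinuousLinearMap.eq_adjoint_iff _ _).2 fun x y => ?_)
  refine Completion.induction_on₂ x y (isClosed_eq (by fun_prop) (by fun_prop)) fun x y => ?_
  rw [completionHom_apply_coe, completionHom_apply_coe, Completion.inner_coe,
    Completion.inner_coe, h]

end CompletionHom

section TensorRep

variable {A B : Type*} [CStarAlgebra A] [CStarAlgebra B] {H K : Type*}
  [NormedAddCommGroup H] [InnerProductSpace ℂ H] [CompleteSpace H]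
  [NormedAddCommGroup K] [InnerProductSpace ℂ K] [CompleteSpace K]

theorem inner_mapL_adjoint (S : H →L[ℂ] H) (T : K →L[ℂ] K) (x y : H ⊗[ℂ] K) :
    inner ℂ (TensorProduct.mapL (star S) (star T) x) y = inner ℂ x (TensorProduct.mapL S T y) := by
  induction x using TensorProduct.induction_on with
  | zero => simp only [map_zero, inner_zero_left]
  | add x x' hx hx' => rw [map_add, inner_add_left, inner_add_left, hx, hx']
  | tmul h k =>
    induction y using TensorProduct.induction_on with
    | zero => simp only [map_zero, inner_zero_right]
    | add y y' hy hy' => rw [map_add, inner_add_right, inner_add_right, hy, hy']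
    | tmul h' k' =>
      simp only [TensorProduct.mapL_tmul, TensorProduct.inner_tmul,
        ContinuousLinearMap.star_eq_adjoint, ContinuousLinearMap.adjoint_inner_left]

variable (π : A →⋆ₐ[ℂ] (H →L[ℂ] H)) (ρ : B →⋆ₐ[ℂ] (K →L[ℂ] K))

theorem tensorRep_tmul (a : A) (b : B) :
    tensorRep π ρ (a ⊗ₜ b) = TensorProduct.mapL (π a) (ρ b) := rfl

theorem inner_tensorRep_star (t : A ⊗[ℂ] B) (x y : H ⊗[ℂ] K) :
    inner ℂ (tensorRep π ρ (star t) x) y = inner ℂ x (tensorRep π ρ t y) := by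
  induction t using TensorProduct.induction_on with
  | zero => simp only [star_zero, map_zero, zero_apply, inner_zero_left, inner_zero_right]
  | add s t hs ht =>
    rw [star_add, map_add, map_add, add_apply, add_apply, inner_add_left, inner_add_right, hs, ht]
  | tmul a b =>
    rw [TensorProduct.star_tmul, tensorRep_tmul, tensorRep_tmul, map_star, map_star,
      inner_mapL_adjoint]

/-- The tensor product of two representations, on the Hilbert space tensor product. -/
def tensorStarRep : A ⊗[ℂ] B →⋆ₐ[ℂ]
    (UniformSpace.Completion (H ⊗[ℂ] K) →L[ℂ] UniformSpace.Completion (H ⊗[ℂ] K)) where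
  toAlgHom := (completionHom (H ⊗[ℂ] K)).comp <|
    Algebra.TensorProduct.algHomOfLinearMapTensorProduct (tensorRep π ρ)
      (fun a a' b b' => by
        simp only [tensorRep_tmul, map_mul, TensorProduct.mapL_mul])
      (by
        rw [tensorRep_tmul, map_one, map_one]
        exact TensorProduct.mapL_id_id)
  map_star' t := (star_completionHom (inner_tensorRep_star π ρ t)).symm

theorem norm_tensorRep_le (t : A ⊗[ℂ] B) : ‖tensorRep π ρ t‖ ≤ ‖tensorStarRep π ρ t‖ :=
  norm_le_norm_completionHom _

end TensorRep

section MinTensorNorm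

theorem enorm_tensorRep_le_minTensorNorm {A : Type u} {B : Type v} [CStarAlgebra A]
    [CStarAlgebra B] {H : Type u} {K : Type v}
    [NormedAddCommGroup H] [InnerProductSpace ℂ H] [CompleteSpace H]
    [NormedAddCommGroup K] [InnerProductSpace ℂ K] [CompleteSpace K]
    (π : A →⋆ₐ[ℂ] (H →L[ℂ] H)) (ρ : B →⋆ₐ[ℂ] (K →L[ℂ] K)) (t : A ⊗[ℂ] B) :
    ‖tensorRep π ρ t‖ₑ ≤ minTensorNorm t :=
  le_iSup_of_le H <| le_iSup_of_le _ <| le_iSup_of_le _ <| le_iSup_of_le inferInstance <|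
    le_iSup_of_le K <| le_iSup_of_le _ <| le_iSup_of_le _ <| le_iSup_of_le inferInstance <|
    le_iSup_of_le π <| le_iSup_of_le ρ le_rfl

variable {X : Type u} [TopologicalSpace X]

/-- Evaluation at a point as a representation on a one-dimensional Hilbert space. -/
def evalRep (x : X) : C(X, ℂ) →⋆ₐ[ℂ]
    (EuclideanSpace ℂ PUnit.{u + 1} →L[ℂ] EuclideanSpace ℂ PUnit.{u + 1}) :=
  (StarAlgHom.ofId ℂ _).comp (evalStarHom ℂ x)

theorem evalRep_apply (x : X) (f : C(X, ℂ)) (h : EuclideanSpace ℂ PUnit.{u + 1}) :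
    evalRep x f h = f x • h := by
  rw [evalRep, StarAlgHom.comp_apply]
  rfl

variable [CompactSpace X] {A : Type v} [CStarAlgebra A]

theorem tensorRep_evalRep {K : Type*} [NormedAddCommGroup K] [InnerProductSpace ℂ K]
    [CompleteSpace K] (ρ : A →⋆ₐ[ℂ] (K →L[ℂ] K)) (x : X) (t : C(X, ℂ) ⊗[ℂ] A)
    (h : EuclideanSpace ℂ PUnit.{u + 1}) (k : K) :
    tensorRep (evalRep x) ρ t (h ⊗ₜ k) = h ⊗ₜ ρ (tensorToFun X A t x) k := by
  induction t using TensorProduct.induction_on with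
  | zero => simp only [map_zero, zero_apply, ContinuousMap.zero_apply, TensorProduct.tmul_zero]
  | add s t hs ht =>
    rw [map_add, map_add, ContinuousMap.add_apply, map_add, add_apply,
      add_apply, TensorProduct.tmul_add, hs, ht]
  | tmul f a =>
    rw [tensorRep_tmul, TensorProduct.mapL_tmul, tensorToFun_tmul, map_smul, smul_apply,
      evalRep_apply, TensorProduct.smul_tmul]

theorem enorm_tensorToFun_apply_le (t : C(X, ℂ) ⊗[ℂ] A) (x : X) :
    ‖tensorToFun X A t x‖ₑ ≤ minTensorNorm t := by
  obtain ⟨K, _, _, _, ρ, ξ, hξ, hρ⟩ := exists_representation_norm_apply_eq (tensorToFun X A t x)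
  refine le_trans ?_ (enorm_tensorRep_le_minTensorNorm (evalRep x) ρ t)
  rw [enorm_le_iff_norm_le]
  let h : EuclideanSpace ℂ PUnit.{u + 1} := EuclideanSpace.single PUnit.unit 1
  have hh : ‖h‖ = 1 := by simp [h]
  have hle := (tensorRep (evalRep x) ρ t).le_opNorm (h ⊗ₜ ξ)
  rw [tensorRep_evalRep, TensorProduct.norm_tmul, TensorProduct.norm_tmul, hρ, hh, one_mul,
    one_mul] at hle
  exact hle.trans (mul_le_of_le_one_right (norm_nonneg _) hξ)

theorem enorm_tensorToFun_le_minTensorNorm (t : C(X, ℂ) ⊗[ℂ] A) :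
    ‖tensorToFun X A t‖ₑ ≤ minTensorNorm t := by
  rcases eq_or_ne (minTensorNorm t) ⊤ with htop | htop
  · exact htop ▸ le_top
  · rw [← ofReal_norm]
    refine ENNReal.ofReal_le_of_le_toReal
      ((ContinuousMap.norm_le _ ENNReal.toReal_nonneg).2 fun x => ?_)
    exact toReal_enorm (tensorToFun X A t x) ▸
      ENNReal.toReal_mono htop (enorm_tensorToFun_apply_le t x)

theorem norm_representation_le [T2Space X] {L : Type*} [NormedAddCommGroup L]
    [InnerProductSpace ℂ L] [CompleteSpace L] (σ : C(X, ℂ) ⊗[ℂ] A →⋆ₐ[ℂ] (L →L[ℂ] L))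
    (t : C(X, ℂ) ⊗[ℂ] A) : ‖σ t‖ ≤ ‖tensorToFun X A t‖ :=
  norm_map_le_norm_tensorToFun (B := L →L[ℂ] L) σ t

theorem minTensorNorm_le_enorm_tensorToFun [T2Space X] (t : C(X, ℂ) ⊗[ℂ] A) :
    minTensorNorm t ≤ ‖tensorToFun X A t‖ₑ := by
  refine iSup_le fun H => iSup_le fun _ => iSup_le fun _ => iSup_le fun _ => iSup_le fun K =>
    iSup_le fun _ => iSup_le fun _ => iSup_le fun _ => iSup_le fun π => iSup_le fun ρ => ?_
  rw [enorm_le_iff_norm_le]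
  exact (norm_tensorRep_le π ρ t).trans (norm_representation_le (tensorStarRep π ρ) t)

theorem enorm_tensorToFun [T2Space X] (t : C(X, ℂ) ⊗[ℂ] A) :
    ‖tensorToFun X A t‖ₑ = minTensorNorm t :=
  (enorm_tensorToFun_le_minTensorNorm t).antisymm (minTensorNorm_le_enorm_tensorToFun t)

end MinTensorNorm

end

theorem mainTheorem11 (X : Type u) [TopologicalSpace X] [CompactSpace X] [T2Space X]
    (A : Type v) [CStarAlgebra A] [PartialOrder A] [StarOrderedRing A] :
    (∃ (hfin : ∀ E : FGPBundle A X, Module.Finite C(X, A)ᵐᵒᵖ E.toHilbertBundle.sections)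
      (hproj : ∀ E : FGPBundle A X, Module.Projective C(X, A)ᵐᵒᵖ E.toHilbertBundle.sections)
      (s : BundleK A X ≃+ KZero C(X, A)),
        ∀ E : FGPBundle A X,
          s E.toK = FGPModule.toK ⟨E.toHilbertBundle.sections, hfin E, hproj E⟩) ∧
    ∃ ι : C(X, ℂ) ⊗[ℂ] A →⋆ₐ[ℂ] C(X, A),
      (∀ (f : C(X, ℂ)) (a : A) (x : X), ι (f ⊗ₜ a) x = f x • a) ∧
      Function.Injective ι ∧ DenseRange ι ∧
      (∀ t, ‖ι t‖ₑ = minTensorNorm t) ∧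
      ∀ (B : Type w) [CStarAlgebra B] (j : C(X, ℂ) ⊗[ℂ] A →⋆ₐ[ℂ] B), Function.Injective j →
        ∀ t, ‖j t‖ = ‖ι t‖ := by
  refine ⟨⟨fun E => E.finite_sections, fun E => E.projective_sections, bundleKEquiv A X,
    bundleKEquiv_toK⟩, tensorToFun X A, tensorToFun_tmul, injective_tensorToFun X A,
    denseRange_tensorToFun X A, enorm_tensorToFun, ?_⟩
  exact fun B _ j hj t => norm_map_eq_of_injective hj t
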